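/- Let $\mathcal A\subseteq B(\mathcal H)$ be a von Neumann algebra on a complex Hilbert space and let $\tau:\mathcal A\to\mathcal A$ be a normal (ultraweakly continuous) unital completely positive map. For $\mu\in\mathbb T=\{z\in\mathbb C:|z|=1\}$ put $E_\mu(\tau)=\{x\in\mathcal A:\tau(x)=\mu x\}$, and let $F(\tau)=E_1(\tau)$. For $x\in E_\mu(\tau)$ and $y\in E_\nu(\tau)$ with $\mu,\nu\in\mathbb T$, their product in the peripheral Poisson boundary of $\tau$ is the limit in the strong operator topology $$x\circ y=\operatorname*{s-lim}_{n\to\infty}(\mu\nu)^{-n}\tau^n(xy).$$ 1. This limit exists and lies in $\mathcal A$. It is the product given by any minimal dilation of $\tau$: let $(\mathcal K,\mathcal B,\theta)$ be such that $\mathcal K\supseteq\mathcal H$ is a Hilbert space, $p$ is the projection of $\mathcal K$ onto $\mathcal H$, operators on $\mathcal H$ are identified with operators on $\mathcal K$ that vanish on $\mathcal H^\perp$, $\mathcal B\subseteq B(\mathcal K)$ is a von Neumann algebra with $\mathcal A\subseteq\mathcal B$ and $\mathcal A=p\mathcal Bp$, $\theta:\mathcal B\to\mathcal B$ is a normal unital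 $*$-endomorphism with $\tau^n(a)=p\theta^n(a)p$ for all $a\in\mathcal A$ and $n\ge 0$, the vectors $\theta^n(a_n)\cdots\theta(a_1)h$ ($n\ge 0$, $a_i\in\mathcal A$, $h\in\mathcal H$) span a dense subspace of $\mathcal K$, and $\mathcal B$ is generated as a von Neumann algebra by $\{\theta^n(a):n\ge 0,\ a\in\mathcal A\}$. Then $x\circ y=T(T^{-1}(x)T^{-1}(y))$, where $T$ is the compression $z\mapsto pzp$ restricted to the norm-closed linear span of $\{z\in\mathcal B:\theta(z)=\mu z\text{ for some }\mu\in\mathbb T\}$. 2. Let $\lambda\in\mathbb T$. If $v_1,v_2\in E_\lambda(\tau)$ satisfy $v_1^*\circ v_2=1$, then $$E_\lambda(\tau)=\{x\circ v_2:x\in F(\tau)\}=\{x\circ v_1:x\in F(\tau)\}.$$ 3. Similarly, if $v_1,v_2\in E_\lambda(\tau)$ satisfy $v_1\circ v_2^*=1$, then $$E_\lambda(\tau)=\{v_2\circ x:x\in F(\tau)\}=\{v_1\circ x:x\in F(\tau)\}.$$ In either case $\dim E_\lambda(\tau)=\dim F(\tau)$, as an equality of (possibly infinite) cardinal numbers.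 -/

import Mathlib

open Filter Topology
open scoped CStarAlgebra InnerProductSpace

universe u v

namespace PeripheralPoisson

section Basic

variable {H : Type u} [NormedAddCommGroup H] [InnerProductSpace ℂ H] [CompleteSpace H]

/-- The elements of a von Neumann algebra `A` of bounded operators on `H`, with the algebraic
operations, the involution, the operator norm and the operator order inherited from `B(H)`. -/
abbrev Elt (A : VonNeumannAlgebra H) : Type u := A.toStarSubalgebra

theorem isClosed_vonNeumannAlgebra (A : VonNeumannAlgebra H) :
    IsClosed (A.toStarSubalgebra : Set (H →L[ℂ] H)) := by
  rw [VonNeumannAlgebra.coe_toStarSubalgebra, ← A.centralizer_centralizer]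
  exact Set.isClosed_centralizer _

noncomputable instance instCStarAlgebraElt (A : VonNeumannAlgebra H) : CStarAlgebra (Elt A) :=
  StarSubalgebra.cstarAlgebra A.toStarSubalgebra (h_closed := isClosed_vonNeumannAlgebra A)

theorem exists_eq_star_mul_self {M : Type*} [CStarAlgebra M] (x : M) (hx : IsSelfAdjoint x)
    (hsp : ∀ r ∈ spectrum ℝ x, 0 ≤ r) : ∃ s : M, x = star s * s := by
  let _ : PartialOrder M := CStarAlgebra.spectralOrder M
  have _ : StarOrderedRing M := CStarAlgebra.spectralOrderedRing M
  have h0 : 0 ≤ x := (StarOrderedRing.nonneg_iff_spectrum_nonneg (R := ℝ) x (ha := hx)).2 hsp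
  exact CStarAlgebra.nonneg_iff_eq_star_mul_self.1 h0

/-- With the operator order, a von Neumann algebra is a star-ordered ring: an element which is
positive as an operator is of the form `star s * s` with `s` in the algebra. -/
instance instStarOrderedRingElt (A : VonNeumannAlgebra H) : StarOrderedRing (Elt A) := by
  have key : ∀ x : Elt A, 0 ≤ x ↔ ∃ s : Elt A, x = star s * s := by
    intro x
    constructor
    · intro hx
      have hx' : (0 : H →L[ℂ] H) ≤ (x : H →L[ℂ] H) := hx
      have hsa : IsSelfAdjoint x := Subtype.ext (IsSelfAdjoint.of_nonneg hx').star_eq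
      have hsp : ∀ r ∈ spectrum ℝ x, 0 ≤ r := by
        intro r hr
        have h1 : (algebraMap ℝ ℂ r) ∈ spectrum ℂ x := spectrum.algebraMap_mem_iff ℂ |>.2 hr
        have h2 : (algebraMap ℝ ℂ r) ∈ spectrum ℂ (x : H →L[ℂ] H) := by
          have := StarSubalgebra.spectrum_eq (S := A.toStarSubalgebra)
            (hS := isClosed_vonNeumannAlgebra A) (a := x)
          rw [← this]; exact h1
        have h3 : r ∈ spectrum ℝ (x : H →L[ℂ] H) := spectrum.algebraMap_mem_iff ℂ |>.1 h2
        exact spectrum_nonneg_of_nonneg hx' h3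
      exact exists_eq_star_mul_self x hsa hsp
    · rintro ⟨s, rfl⟩
      have : (0 : H →L[ℂ] H) ≤ star (s : H →L[ℂ] H) * (s : H →L[ℂ] H) := star_mul_self_nonneg _
      exact this
  refine StarOrderedRing.of_nonneg_iff' (fun {x y} hxy z => ?_) key
  have h : (x : H →L[ℂ] H) ≤ (y : H →L[ℂ] H) := hxy
  have : (z : H →L[ℂ] H) + (x : H →L[ℂ] H) ≤ (z : H →L[ℂ] H) + (y : H →L[ℂ] H) := by gcongr
  exact this

/-- `φ` is a normal (that is, ultraweakly continuous) linear functional on `A`: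
`φ a = ∑ ⟨ξ n, a (η n)⟩` for square-summable sequences of vectors `ξ` and `η`. -/
def IsNormalFunctional (A : VonNeumannAlgebra H) (φ : Elt A → ℂ) : Prop :=
  ∃ ξ η : ℕ → H, Summable (fun n => ‖ξ n‖ ^ 2) ∧ Summable (fun n => ‖η n‖ ^ 2) ∧
    ∀ a : Elt A, HasSum (fun n => ⟪ξ n, (a : H →L[ℂ] H) (η n)⟫_ℂ) (φ a)

/-- A linear self-map of a von Neumann algebra is normal if it is ultraweakly continuous, that is,
if it pulls normal functionals back to normal functionals. -/
def IsNormal {A : VonNeumannAlgebra H} (f : Module.End ℂ (Elt A)) : Prop :=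
  ∀ φ : Elt A → ℂ, IsNormalFunctional A φ → IsNormalFunctional A (fun a => φ (f a))

/-- The eigenspace `E_μ(f) = {x | f x = μ x}`, for `μ` on the unit circle. -/
noncomputable abbrev eig {A : VonNeumannAlgebra H} (f : Module.End ℂ (Elt A)) (μ : Circle) :
    Submodule ℂ (Elt A) :=
  Module.End.eigenspace f (μ : ℂ)

/-- The space `F(f) = E_1(f)` of fixed points of `f`. -/
noncomputable abbrev fix {A : VonNeumannAlgebra H} (f : Module.End ℂ (Elt A)) : Submodule ℂ (Elt A) :=
  eig f 1

/-- The norm closure of the linear span of all peripheral eigenvectors of `f`. -/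
noncomputable def peripheralSpace {A : VonNeumannAlgebra H} (f : Module.End ℂ (Elt A)) :
    Submodule ℂ (Elt A) :=
  (⨆ μ : Circle, eig f μ).topologicalClosure

/-- `a` is the limit of the sequence `s` in the strong operator topology. -/
def IsStrongLimit {A : VonNeumannAlgebra H} (s : ℕ → Elt A) (a : Elt A) : Prop :=
  ∀ h : H, Tendsto (fun n => (s n : H →L[ℂ] H) h) atTop (𝓝 ((a : H →L[ℂ] H) h))

/-- The sequence `(μ ν)⁻ⁿ fⁿ(x y)`. -/
noncomputable def rotated {A : VonNeumannAlgebra H} (f : Module.End ℂ (Elt A))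
    (μ ν : Circle) (x y : Elt A) (n : ℕ) : Elt A :=
  (((μ * ν)⁻¹ ^ n : Circle) : ℂ) • (f ^ n) (x * y)

open Classical in
/-- The product `x ∘ y` of two peripheral eigenvectors `x ∈ E_μ(f)`, `y ∈ E_ν(f)`: the strong limit
of `(μ ν)⁻ⁿ fⁿ(x y)`. (An arbitrary element if there is no such limit.) -/
noncomputable def pmul {A : VonNeumannAlgebra H} (f : Module.End ℂ (Elt A)) (x y : Elt A) :
    Elt A :=
  Classical.epsilon fun z => ∃ μ ν : Circle, x ∈ eig f μ ∧ y ∈ eig f ν ∧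
    IsStrongLimit (rotated f μ ν x y) z

end Basic

section Dilation

variable {H : Type u} [NormedAddCommGroup H] [InnerProductSpace ℂ H] [CompleteSpace H]
variable {K : Type v} [NormedAddCommGroup K] [InnerProductSpace ℂ K] [CompleteSpace K]

/-- An operator `a` on `H`, regarded as the operator `V a V*` on the larger space `K`. -/
noncomputable def amplify (V : H →ₗᵢ[ℂ] K) (a : H →L[ℂ] H) : K →L[ℂ] K :=
  V.toContinuousLinearMap ∘L a ∘L ContinuousLinearMap.adjoint V.toContinuousLinearMap

/-- The compression `V* b V` to `H` of an operator `b` on `K`. -/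
noncomputable def compress (V : H →ₗᵢ[ℂ] K) (b : K →L[ℂ] K) : H →L[ℂ] H :=
  ContinuousLinearMap.adjoint V.toContinuousLinearMap ∘L b ∘L V.toContinuousLinearMap

/-- The vector `θⁿ(xₙ) ⋯ θ²(x₂) θ(x₁) h`, where `x₁, …, xₙ` are `x 0, …, x (n - 1)` and `j` is the
identification of elements of `A` with elements of `B`. -/
noncomputable def word {A : VonNeumannAlgebra H} {B : VonNeumannAlgebra K} (V : H →ₗᵢ[ℂ] K)
    (j : Elt A → Elt B) (θ : Module.End ℂ (Elt B)) (x : ℕ → Elt A) (h : H) : ℕ → K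
  | 0 => V h
  | n + 1 => (((θ ^ (n + 1)) (j (x n)) : Elt B) : K →L[ℂ] K) (word V j θ x h n)

/-- A minimal dilation of a map `τ` on `A ⊆ B(H)`, acting on the Hilbert space `K`. The inclusion
of `H` as a closed subspace of `K` is given by an isometry `V`, and `a ∈ B(H)` is identified with
`V a V* ∈ B(K)`. -/
structure MinimalDilation {A : VonNeumannAlgebra H} (τ : Module.End ℂ (Elt A)) (K : Type v)
    [NormedAddCommGroup K] [InnerProductSpace ℂ K] [CompleteSpace K] where
  /-- the inclusion of `H` into `K` -/
  V : H →ₗᵢ[ℂ] K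
  /-- the dilated von Neumann algebra -/
  B : VonNeumannAlgebra K
  /-- the dilated dynamics, a unital `*`-endomorphism -/
  θ : Elt B →⋆ₐ[ℂ] Elt B
  /-- `A ⊆ B` -/
  amplify_mem : ∀ a : Elt A, amplify V (a : H →L[ℂ] H) ∈ B.toStarSubalgebra
  /-- `p B p ⊆ A`; together with `A ⊆ B` this says `A = p B p` -/
  compress_mem : ∀ b : Elt B, compress V (b : K →L[ℂ] K) ∈ A.toStarSubalgebra
  /-- `θ` is normal -/
  normal : IsNormal θ.toAlgHom.toLinearMap
  /-- the dilation property -/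
  dilates : ∀ (n : ℕ) (a : Elt A), (((τ ^ n) a : Elt A) : H →L[ℂ] H) =
    compress V (((θ.toAlgHom.toLinearMap ^ n) ⟨_, amplify_mem a⟩ : Elt B) : K →L[ℂ] K)
  /-- minimality of the space -/
  minimal_space : (Submodule.span ℂ {k : K | ∃ (n : ℕ) (x : ℕ → Elt A) (h : H),
    k = word V (fun a => (⟨_, amplify_mem a⟩ : Elt B)) θ.toAlgHom.toLinearMap x h n}
      ).topologicalClosure = ⊤
  /-- minimality of the algebra: `B` is the double commutant of `{θⁿ(a) | a ∈ A}` -/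
  minimal_algebra : (B : Set (K →L[ℂ] K)) = Set.centralizer (Set.centralizer
    {b : K →L[ℂ] K | ∃ (n : ℕ) (a : Elt A),
      b = (((θ.toAlgHom.toLinearMap ^ n) ⟨_, amplify_mem a⟩ : Elt B) : K →L[ℂ] K)})

namespace MinimalDilation

variable {A : VonNeumannAlgebra H} {τ : Module.End ℂ (Elt A)}

/-- The compression map `T : B → A`. -/
noncomputable def T (D : MinimalDilation τ K) (b : Elt D.B) : Elt A :=
  ⟨compress D.V (b : K →L[ℂ] K), D.compress_mem b⟩

/-- The inverse of `T` restricted to the peripheral space `P(θ)`. -/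
noncomputable def lift (D : MinimalDilation τ K) (x : Elt A) : Elt D.B :=
  Function.invFunOn D.T (peripheralSpace D.θ.toAlgHom.toLinearMap : Set (Elt D.B)) x

/-- The product `T (T⁻¹ x * T⁻¹ y)` on the peripheral Poisson boundary `P(τ)`. -/
noncomputable def mul (D : MinimalDilation τ K) (x y : Elt A) : Elt A :=
  D.T (D.lift x * D.lift y)

end MinimalDilation

end Dilation

end PeripheralPoisson

open PeripheralPoisson

theorem CStarAlgebra.exists_eq_star_mul_self_of_nonneg {R : Type*} [NonUnitalCStarAlgebra R]
    [PartialOrder R] [StarOrderedRing R] {x : R} (hx : 0 ≤ x) : ∃ s : R, x = star s * s :=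
  CStarAlgebra.nonneg_iff_eq_star_mul_self.1 hx

theorem CStarMatrix.exists_gram_of_nonneg {R : Type*} [CStarAlgebra R] [PartialOrder R]
    [StarOrderedRing R] {k : ℕ} {M : CStarMatrix (Fin k) (Fin k) R} (hM : 0 ≤ M) :
    ∃ N : CStarMatrix (Fin k) (Fin k) R, ∀ i j, M i j = ∑ l, star (N l i) * N l j := by
  obtain ⟨N, hN⟩ := CStarAlgebra.exists_eq_star_mul_self_of_nonneg hM
  refine ⟨N, fun i j => ?_⟩
  rw [hN, CStarMatrix.mul_apply]
  rfl

namespace PeripheralPoisson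

section Positivity

variable {H : Type u} [NormedAddCommGroup H] [InnerProductSpace ℂ H] [CompleteSpace H]
variable {A : VonNeumannAlgebra H}

/-- Entrywise application of `f` preserves positivity of matrices over `A`. -/
def PreservesMatrixNonneg (f : Module.End ℂ (Elt A)) : Prop :=
  ∀ (k : ℕ) (M : CStarMatrix (Fin k) (Fin k) (Elt A)), 0 ≤ M → 0 ≤ M.map f

theorem PreservesMatrixNonneg.pow {f : Module.End ℂ (Elt A)} (hf : PreservesMatrixNonneg f)
    (n : ℕ) : PreservesMatrixNonneg (f ^ n) := by
  induction n with
  | zero => intro k M hM; exact hM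
  | succ n ih =>
    intro k M hM
    have := hf k _ (ih k M hM)
    rw [pow_succ']
    exact this

theorem pow_one_eq {f : Module.End ℂ (Elt A)} (h : f 1 = 1) (n : ℕ) : (f ^ n) 1 = 1 := by
  induction n with
  | zero => simp
  | succ n ih => rw [pow_succ', Module.End.mul_apply, ih, h]

theorem exists_gram {k : ℕ} {M : CStarMatrix (Fin k) (Fin k) (Elt A)} (hM : 0 ≤ M) :
    ∃ N : CStarMatrix (Fin k) (Fin k) (Elt A), ∀ i j, M i j = ∑ l, star (N l i) * N l j :=
  CStarMatrix.exists_gram_of_nonneg hM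

theorem gram_nonneg {k : ℕ} (N : Fin k → Fin k → Elt A) :
    (0 : CStarMatrix (Fin k) (Fin k) (Elt A)) ≤
      CStarMatrix.ofMatrix (fun i j => ∑ l, star (N l i) * N l j) := by
  have h : CStarMatrix.ofMatrix (fun i j => ∑ l, star (N l i) * N l j) =
      star (CStarMatrix.ofMatrix N) * CStarMatrix.ofMatrix N := by
    ext i j
    rw [CStarMatrix.mul_apply]
    rfl
  rw [h]
  exact star_mul_self_nonneg _

/-- The defect `f (a* b) - f(a)* f(b)`. -/
noncomputable def defect (f : Module.End ℂ (Elt A)) (a b : Elt A) : Elt A :=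
  f (star a * b) - star (f a) * f b

theorem map_star_of_preserves {f : Module.End ℂ (Elt A)} (hf : PreservesMatrixNonneg f)
    (a : Elt A) : f (star a) = star (f a) := by
  let x : Fin 2 → Elt A := ![1, a]
  have h0 : (0 : CStarMatrix (Fin 2) (Fin 2) (Elt A)) ≤
      CStarMatrix.ofMatrix (fun i j => star (x i) * x j) := by
    have := gram_nonneg (fun l j : Fin 2 => if l = 0 then x j else 0)
    simpa [Fin.sum_univ_two] using this
  obtain ⟨N, hN⟩ := exists_gram (hf 2 _ h0)
  have h1 : f (star a) = ∑ l, star (N l 1) * N l 0 := by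
    rw [← hN 1 0]; change _ = f (star (x 1) * x 0); simp [x]
  have h2 : f a = ∑ l, star (N l 0) * N l 1 := by
    rw [← hN 0 1]; change _ = f (star (x 0) * x 1); simp [x]
  rw [h1, h2, star_sum]
  simp

theorem defect_nonneg {f : Module.End ℂ (Elt A)} (hf : PreservesMatrixNonneg f) (h1 : f 1 = 1)
    (a b : Elt A) : (0 : CStarMatrix (Fin 3) (Fin 3) (Elt A)) ≤
      CStarMatrix.ofMatrix (fun i j => defect f (![1, a, b] i) (![1, a, b] j)) := by
  set x : Fin 3 → Elt A := ![1, a, b] with hx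
  have h0 : (0 : CStarMatrix (Fin 3) (Fin 3) (Elt A)) ≤
      CStarMatrix.ofMatrix (fun i j => star (x i) * x j) := by
    have := gram_nonneg (fun l j : Fin 3 => if l = 0 then x j else 0)
    simpa [Fin.sum_univ_three] using this
  obtain ⟨N, hN⟩ := exists_gram (hf 3 _ h0)
  have hN' : ∀ i j, f (star (x i) * x j) = ∑ l, star (N l i) * N l j := fun i j => hN i j
  have e0 : ∀ j, f (x j) = ∑ l, star (N l 0) * N l j := by
    intro j; rw [← hN' 0 j]; simp [hx]
  have e0' : ∀ i, star (f (x i)) = ∑ l, star (N l i) * N l 0 := by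
    intro i; rw [e0, star_sum]; simp
  have e00 : ∑ l, star (N l 0) * N l 0 = 1 := by
    rw [← e0 0, hx]; simpa using h1
  have key : (fun i j => defect f (x i) (x j)) =
      fun i j => ∑ l, star (N l i - N l 0 * f (x i)) * (N l j - N l 0 * f (x j)) := by
    funext i j
    have : ∀ l, star (N l i - N l 0 * f (x i)) * (N l j - N l 0 * f (x j)) =
        star (N l i) * N l j - (star (N l i) * N l 0) * f (x j)
        - star (f (x i)) * (star (N l 0) * N l j)
        + star (f (x i)) * (star (N l 0) * N l 0) * f (x j) := by
      intro l
      rw [star_sub, star_mul]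
      noncomm_ring
    simp only [this]
    rw [Finset.sum_add_distrib, Finset.sum_sub_distrib, Finset.sum_sub_distrib, ← Finset.sum_mul,
      ← Finset.mul_sum, ← Finset.sum_mul, ← Finset.mul_sum, e00, ← e0, ← e0', ← hN', defect]
    noncomm_ring
  rw [key]
  exact gram_nonneg _

/-- The Cauchy–Schwarz inequality for the entries of a Gram matrix of operators. -/
theorem gram_inner_sq_le {k : ℕ} (a b : Fin k → Elt A) (g h : H) :
    ‖⟪g, ((∑ l, star (a l) * b l : Elt A) : H →L[ℂ] H) h⟫_ℂ‖ ^ 2 ≤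
      (⟪g, ((∑ l, star (a l) * a l : Elt A) : H →L[ℂ] H) g⟫_ℂ).re *
      (⟪h, ((∑ l, star (b l) * b l : Elt A) : H →L[ℂ] H) h⟫_ℂ).re := by
  have key : ∀ (c d : Fin k → Elt A) (x y : H),
      ⟪x, ((∑ l, star (c l) * d l : Elt A) : H →L[ℂ] H) y⟫_ℂ =
        ∑ l, ⟪(c l : H →L[ℂ] H) x, (d l : H →L[ℂ] H) y⟫_ℂ := by
    intro c d x y
    rw [AddSubmonoidClass.coe_finsetSum, sum_apply, inner_sum]
    refine Finset.sum_congr rfl fun l _ => ?_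
    have : ((star (c l) * d l : Elt A) : H →L[ℂ] H) y =
        ContinuousLinearMap.adjoint (c l : H →L[ℂ] H) ((d l : H →L[ℂ] H) y) := rfl
    rw [this, ContinuousLinearMap.adjoint_inner_right]
  have hsq : ∀ (c : Fin k → Elt A) (x : H),
      (⟪x, ((∑ l, star (c l) * c l : Elt A) : H →L[ℂ] H) x⟫_ℂ).re =
        ∑ l, ‖(c l : H →L[ℂ] H) x‖ ^ 2 := by
    intro c x
    rw [key, Complex.re_sum]
    refine Finset.sum_congr rfl fun l _ => ?_
    rw [inner_self_eq_norm_sq_to_K]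
    norm_cast
  rw [key, hsq, hsq]
  calc ‖∑ l, ⟪(a l : H →L[ℂ] H) g, (b l : H →L[ℂ] H) h⟫_ℂ‖ ^ 2
      ≤ (∑ l, ‖(a l : H →L[ℂ] H) g‖ * ‖(b l : H →L[ℂ] H) h‖) ^ 2 := by
        gcongr
        exact (norm_sum_le _ _).trans (Finset.sum_le_sum fun l _ => norm_inner_le_norm _ _)
    _ ≤ _ := Finset.sum_mul_sq_le_sq_mul_sq _ _ _

theorem inner_map_defect_sq_le {f s : Module.End ℂ (Elt A)} (hf : PreservesMatrixNonneg f)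
    (hs : PreservesMatrixNonneg s) (h1 : s 1 = 1) (a b : Elt A) (g h : H) :
    ‖⟪g, (f (defect s a b) : H →L[ℂ] H) h⟫_ℂ‖ ^ 2 ≤
      (⟪g, (f (defect s a a) : H →L[ℂ] H) g⟫_ℂ).re *
      (⟪h, (f (defect s b b) : H →L[ℂ] H) h⟫_ℂ).re := by
  obtain ⟨N, hN⟩ := exists_gram (hf 3 _ (defect_nonneg hs h1 a b))
  have h12 : f (defect s a b) = ∑ l, star (N l 1) * N l 2 := hN 1 2
  have h11 : f (defect s a a) = ∑ l, star (N l 1) * N l 1 := hN 1 1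
  have h22 : f (defect s b b) = ∑ l, star (N l 2) * N l 2 := hN 2 2
  rw [h12, h11, h22]
  exact gram_inner_sq_le _ _ _ _

theorem inner_map_star_mul_self_nonneg {f : Module.End ℂ (Elt A)} (hf : PreservesMatrixNonneg f)
    (a : Elt A) (g : H) : 0 ≤ (⟪g, (f (star a * a) : H →L[ℂ] H) g⟫_ℂ).re := by
  obtain ⟨N, hN⟩ := exists_gram (hf 1 _ (gram_nonneg (fun _ _ : Fin 1 => a)))
  have h : f (star a * a) = ∑ l, star (N l 0) * N l 0 := by
    rw [← hN 0 0]; change _ = f (∑ _l : Fin 1, star a * a); simp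
  rw [h]
  simp only [Finset.univ_unique, Finset.sum_singleton]
  have : ((star (N default 0) * N default 0 : Elt A) : H →L[ℂ] H) g =
      ContinuousLinearMap.adjoint (N default 0 : H →L[ℂ] H) ((N default 0 : H →L[ℂ] H) g) := rfl
  rw [this, ContinuousLinearMap.adjoint_inner_right]
  exact inner_self_nonneg (𝕜 := ℂ)

theorem inner_map_defect_nonneg {f s : Module.End ℂ (Elt A)} (hf : PreservesMatrixNonneg f)
    (hs : PreservesMatrixNonneg s) (h1 : s 1 = 1) (a : Elt A) (g : H) :
    0 ≤ (⟪g, (f (defect s a a) : H →L[ℂ] H) g⟫_ℂ).re := by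
  obtain ⟨N, hN⟩ := exists_gram (defect_nonneg hs h1 a a)
  have h : defect s a a = ∑ l, star (N l 1) * N l 1 := hN 1 1
  rw [h, map_sum, AddSubmonoidClass.coe_finsetSum, sum_apply, inner_sum,
    Complex.re_sum]
  exact Finset.sum_nonneg fun l _ => inner_map_star_mul_self_nonneg hf _ _

theorem inner_map_star_mul_self_le {f : Module.End ℂ (Elt A)} (hf : PreservesMatrixNonneg f)
    (h1 : f 1 = 1) (a : Elt A) (g : H) :
    (⟪g, (f (star a * a) : H →L[ℂ] H) g⟫_ℂ).re ≤ ‖a‖ ^ 2 * ‖g‖ ^ 2 := by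
  have h : star a * a ≤ algebraMap ℝ (Elt A) (‖a‖ ^ 2) :=
    CStarAlgebra.star_mul_le_algebraMap_norm_sq
  obtain ⟨s, hs⟩ := CStarAlgebra.nonneg_iff_eq_star_mul_self.1 (sub_nonneg.2 h)
  have h2 := inner_map_star_mul_self_nonneg hf s g
  have h3 : algebraMap ℝ (Elt A) (‖a‖ ^ 2) = ((‖a‖ ^ 2 : ℝ) : ℂ) • (1 : Elt A) := by
    rw [Algebra.algebraMap_eq_smul_one]
    exact (Complex.coe_smul _ _).symm
  have h4 : (f (((‖a‖ ^ 2 : ℝ) : ℂ) • (1 : Elt A)) : H →L[ℂ] H) g =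
      ((‖a‖ ^ 2 : ℝ) : ℂ) • g := by
    rw [map_smul, h1]; rfl
  rw [← hs, map_sub, h3] at h2
  have h5 : ((f (((‖a‖ ^ 2 : ℝ) : ℂ) • (1 : Elt A)) - f (star a * a) : Elt A) : H →L[ℂ] H) g =
    ((‖a‖ ^ 2 : ℝ) : ℂ) • g - (f (star a * a) : H →L[ℂ] H) g := by
    rw [← h4]; rfl
  rw [h5, inner_sub_right, inner_smul_right, inner_self_eq_norm_sq_to_K, Complex.sub_re] at h2
  have h6 : ((((‖a‖ ^ 2 : ℝ) : ℂ) * ((‖g‖ : ℂ)) ^ 2)).re = ‖a‖ ^ 2 * ‖g‖ ^ 2 := by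
    norm_cast
  erw [h6] at h2
  linarith

theorem norm_apply_sq_eq (a : Elt A) (g : H) :
    ‖(a : H →L[ℂ] H) g‖ ^ 2 = (⟪g, ((star a * a : Elt A) : H →L[ℂ] H) g⟫_ℂ).re := by
  have : ((star a * a : Elt A) : H →L[ℂ] H) g =
      ContinuousLinearMap.adjoint (a : H →L[ℂ] H) ((a : H →L[ℂ] H) g) := rfl
  rw [this, ContinuousLinearMap.adjoint_inner_right, inner_self_eq_norm_sq_to_K]
  norm_cast

theorem norm_map_le {f : Module.End ℂ (Elt A)} (hf : PreservesMatrixNonneg f)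
    (h1 : f 1 = 1) (a : Elt A) : ‖f a‖ ≤ ‖a‖ := by
  refine ContinuousLinearMap.opNorm_le_bound (f a : H →L[ℂ] H) (norm_nonneg a) fun g => ?_
  refine le_of_sq_le_sq ?_ (by positivity)
  have h2 := inner_map_defect_nonneg (f := 1) (fun _ M hM => hM) hf h1 a g
  have h3 := inner_map_star_mul_self_le hf h1 a g
  have h4 : ((((1 : Module.End ℂ (Elt A)) (defect f a a) : Elt A)) : H →L[ℂ] H) g =
      (f (star a * a) : H →L[ℂ] H) g - ((star (f a) * f a : Elt A) : H →L[ℂ] H) g := rfl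
  rw [h4, inner_sub_right, Complex.sub_re, ← norm_apply_sq_eq] at h2
  rw [mul_pow]
  linarith

theorem inner_map_defect_le {f s : Module.End ℂ (Elt A)} (hf : PreservesMatrixNonneg f)
    (hf1 : f 1 = 1) (hs : PreservesMatrixNonneg s) (h1 : s 1 = 1) (a : Elt A) (g : H) :
    (⟪g, (f (defect s a a) : H →L[ℂ] H) g⟫_ℂ).re ≤ ‖a‖ ^ 2 * ‖g‖ ^ 2 := by
  have hfs : PreservesMatrixNonneg (f * s) := fun k M hM => hf k _ (hs k M hM)
  have h2 := inner_map_star_mul_self_le hfs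
    (by rw [Module.End.mul_apply, h1, hf1]) a g
  have h3 := inner_map_star_mul_self_nonneg hf (s a) g
  have h4 : (f (defect s a a) : H →L[ℂ] H) g =
      (f (s (star a * a)) : H →L[ℂ] H) g - (f (star (s a) * s a) : H →L[ℂ] H) g := by
    rw [defect, map_sub]; rfl
  rw [h4, inner_sub_right, Complex.sub_re]
  rw [Module.End.mul_apply] at h2
  linarith

end Positivity

end PeripheralPoisson

theorem cauchySeq_of_norm_sq_sub_le {E : Type*} [SeminormedAddCommGroup E] {s : ℕ → E} {q : ℕ → ℝ}
    {C B : ℝ} (hC : 0 ≤ C) (hq : Monotone q) (hB : ∀ n, q n ≤ B)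
    (h : ∀ n m, ‖s (n + m) - s n‖ ^ 2 ≤ C * (q (n + m) - q n)) : CauchySeq s := by
  obtain ⟨l, hl⟩ := tendsto_atTop_of_monotone hq |>.resolve_left fun h' =>
    (h'.eventually_gt_atTop B).exists.elim fun n hn => absurd (hB n) (not_le.2 hn)
  have hql : ∀ n, q n ≤ l := hq.ge_of_tendsto hl
  refine cauchySeq_of_le_tendsto_0' (fun n => √(C * (l - q n))) (fun n m hnm => ?_) ?_
  · obtain ⟨m, rfl⟩ := Nat.exists_eq_add_of_le hnm
    rw [dist_comm, dist_eq_norm]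
    refine Real.le_sqrt_of_sq_le ((h n m).trans ?_)
    gcongr
    exact hql _
  · have : Tendsto (fun n => √(C * (l - q n))) atTop (𝓝 √(C * (l - l))) :=
      ((tendsto_const_nhds.sub hl).const_mul C).sqrt
    simpa using this

theorem tendsto_of_approx {E : Type*} [SeminormedAddCommGroup E] {t u : ℕ → E} {U : ℕ → ℕ → E}
    {L : E} {e : ℕ → ℝ} (he : Tendsto e atTop (𝓝 0)) (hu : Tendsto u atTop (𝓝 L))
    (hU : ∀ n, Tendsto (U n) atTop (𝓝 (u n))) (h : ∀ n m, ‖t (n + m) - U n m‖ ≤ e n) :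
    Tendsto t atTop (𝓝 L) := by
  rw [Metric.tendsto_atTop]
  intro ε hε
  obtain ⟨n, hn1, hn2⟩ := ((he.eventually (gt_mem_nhds (show (0 : ℝ) < ε / 3 by positivity))).and
    (Metric.tendsto_nhds.1 hu (ε / 3) (by positivity))).exists
  obtain ⟨m₀, hm⟩ := Metric.tendsto_atTop.1 (hU n) (ε / 3) (by positivity)
  refine ⟨n + m₀, fun N hN => ?_⟩
  obtain ⟨m, rfl⟩ := Nat.exists_eq_add_of_le (show n ≤ N by omega)
  have h3 := hm m (by omega)
  have h4 := h n m
  rw [← dist_eq_norm] at h4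
  calc dist (t (n + m)) L ≤ dist (t (n + m)) (U n m) + dist (U n m) (u n) + dist (u n) L :=
        dist_triangle4 _ _ _ _
    _ < ε := by linarith

namespace PeripheralPoisson

section Limits

variable {H : Type u} [NormedAddCommGroup H] [InnerProductSpace ℂ H] [CompleteSpace H]
variable {A : VonNeumannAlgebra H}

/-- `a` is the limit of the sequence `s` in the weak operator topology. -/
def IsWeakLimit (s : ℕ → Elt A) (a : Elt A) : Prop :=
  ∀ g h : H, Tendsto (fun n => ⟪g, (s n : H →L[ℂ] H) h⟫_ℂ) atTop
    (𝓝 ⟪g, (a : H →L[ℂ] H) h⟫_ℂ)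

theorem IsStrongLimit.isWeakLimit {s : ℕ → Elt A} {a : Elt A} (h : IsStrongLimit s a) :
    IsWeakLimit s a := fun _ k => tendsto_const_nhds.inner (h k)

theorem elt_ext {a b : Elt A} (h : ∀ k, (a : H →L[ℂ] H) k = (b : H →L[ℂ] H) k) : a = b :=
  Subtype.ext (ContinuousLinearMap.ext h)

theorem IsWeakLimit.unique {s : ℕ → Elt A} {a b : Elt A} (ha : IsWeakLimit s a)
    (hb : IsWeakLimit s b) : a = b :=
  elt_ext fun k => ext_inner_left ℂ fun g => tendsto_nhds_unique (ha g k) (hb g k)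

theorem IsStrongLimit.unique {s : ℕ → Elt A} {a b : Elt A} (ha : IsStrongLimit s a)
    (hb : IsStrongLimit s b) : a = b := ha.isWeakLimit.unique hb.isWeakLimit

theorem IsStrongLimit.add {s t : ℕ → Elt A} {a b : Elt A} (ha : IsStrongLimit s a)
    (hb : IsStrongLimit t b) : IsStrongLimit (fun n => s n + t n) (a + b) :=
  fun k => (ha k).add (hb k)

theorem IsStrongLimit.smul {s : ℕ → Elt A} {a : Elt A} (c : ℂ) (ha : IsStrongLimit s a) :
    IsStrongLimit (fun n => c • s n) (c • a) :=
  fun k => (ha k).const_smul c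

theorem IsWeakLimit.smul {s : ℕ → Elt A} {a : Elt A} (c : ℂ) (ha : IsWeakLimit s a) :
    IsWeakLimit (fun n => c • s n) (c • a) := by
  intro g k
  have h1 : ∀ b : Elt A, ⟪g, ((c • b : Elt A) : H →L[ℂ] H) k⟫_ℂ =
      c * ⟪g, (b : H →L[ℂ] H) k⟫_ℂ := fun b => inner_smul_right g ((b : H →L[ℂ] H) k) c
  simp only [h1]
  exact (ha g k).const_mul c

theorem inner_star_apply (a : Elt A) (g k : H) :
    ⟪g, ((star a : Elt A) : H →L[ℂ] H) k⟫_ℂ = ⟪(a : H →L[ℂ] H) g, k⟫_ℂ :=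
  ContinuousLinearMap.adjoint_inner_right _ _ _

theorem IsWeakLimit.star {s : ℕ → Elt A} {a : Elt A} (ha : IsWeakLimit s a) :
    IsWeakLimit (fun n => star (s n)) (star a) := by
  intro g k
  simp only [inner_star_apply]
  have := (ha k g).star
  simpa only [RCLike.star_def, inner_conj_symm] using this

theorem IsStrongLimit.mul {s t : ℕ → Elt A} {a b : Elt A} {C : ℝ} (hC : ∀ n, ‖s n‖ ≤ C)
    (ha : IsStrongLimit s a) (hb : IsStrongLimit t b) :
    IsStrongLimit (fun n => s n * t n) (a * b) := by
  intro k
  change Tendsto (fun n => (s n : H →L[ℂ] H) ((t n : H →L[ℂ] H) k)) atTop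
    (𝓝 ((a : H →L[ℂ] H) ((b : H →L[ℂ] H) k)))
  have h1 : Tendsto (fun n => (s n : H →L[ℂ] H) ((t n : H →L[ℂ] H) k - (b : H →L[ℂ] H) k))
      atTop (𝓝 0) := by
    have h2 : Tendsto (fun n => C * ‖(t n : H →L[ℂ] H) k - (b : H →L[ℂ] H) k‖) atTop (𝓝 0) := by
      simpa using ((hb k).sub_const ((b : H →L[ℂ] H) k)).norm.const_mul C
    exact squeeze_zero_norm (fun n => ContinuousLinearMap.le_of_opNorm_le _ (hC n) _) h2
  have h3 := h1.add (ha ((b : H →L[ℂ] H) k))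
  simpa using h3

/-- A von Neumann algebra is closed under strong limits of sequences. -/
theorem exists_isStrongLimit {s : ℕ → Elt A}
    (hs : ∀ k : H, CauchySeq (fun n => (s n : H →L[ℂ] H) k)) : ∃ a, IsStrongLimit s a := by
  choose f hf using fun k => cauchySeq_tendsto_of_complete (hs k)
  let F : H →L[ℂ] H := continuousLinearMapOfTendsto (fun n => (s n : H →L[ℂ] H))
    (f := f) (tendsto_pi_nhds.2 hf)
  have hF : ∀ k, Tendsto (fun n => (s n : H →L[ℂ] H) k) atTop (𝓝 (F k)) := hf
  refine ⟨⟨F, ?_⟩, hF⟩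
  change F ∈ (A : Set (H →L[ℂ] H))
  rw [← A.centralizer_centralizer]
  intro g hg
  ext k
  have h1 : ∀ n, g ((s n : H →L[ℂ] H) k) = (s n : H →L[ℂ] H) (g k) := fun n =>
    (DFunLike.congr_fun (hg (s n : H →L[ℂ] H) (s n).2) k).symm
  have h2 := (g.continuous.tendsto _).comp (hF k)
  exact tendsto_nhds_unique h2 ((hF (g k)).congr fun n => (h1 n).symm)

theorem isNormalFunctional_inner (g k : H) :
    IsNormalFunctional A (fun a => ⟪g, (a : H →L[ℂ] H) k⟫_ℂ) := by
  refine ⟨Pi.single 0 g, Pi.single 0 k, ?_, ?_, fun a => ?_⟩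
  · refine summable_of_ne_finset_zero (s := {0}) fun n hn => ?_
    rw [Pi.single_eq_of_ne (by simpa using hn)]; simp
  · refine summable_of_ne_finset_zero (s := {0}) fun n hn => ?_
    rw [Pi.single_eq_of_ne (by simpa using hn)]; simp
  · have := hasSum_single (f := fun n => ⟪(Pi.single 0 g : ℕ → H) n,
      (a : H →L[ℂ] H) ((Pi.single 0 k : ℕ → H) n)⟫_ℂ) 0 (fun n hn => by
        rw [Pi.single_eq_of_ne hn]; simp)
    simpa using this

theorem IsNormalFunctional.tendsto {ψ : Elt A → ℂ} (hψ : IsNormalFunctional A ψ) {s : ℕ → Elt A}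
    {a : Elt A} {C : ℝ} (hC : ∀ n, ‖s n‖ ≤ C) (h : IsWeakLimit s a) :
    Tendsto (fun n => ψ (s n)) atTop (𝓝 (ψ a)) := by
  obtain ⟨ξ, η, hξ, hη, hsum⟩ := hψ
  have h1 : ∀ b, ψ b = ∑' i, ⟪ξ i, (b : H →L[ℂ] H) (η i)⟫_ℂ := fun b => (hsum b).tsum_eq.symm
  simp only [h1]
  refine tendsto_tsum_of_dominated_convergence (bound := fun i => C * (‖ξ i‖ ^ 2 + ‖η i‖ ^ 2))
    ((hξ.add hη).mul_left C) (fun i => h _ _) (Eventually.of_forall fun n i => ?_)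
  have hC0 : 0 ≤ C := (norm_nonneg _).trans (hC n)
  calc ‖⟪ξ i, (s n : H →L[ℂ] H) (η i)⟫_ℂ‖ ≤ ‖ξ i‖ * (C * ‖η i‖) :=
        (norm_inner_le_norm _ _).trans
          (mul_le_mul_of_nonneg_left (ContinuousLinearMap.le_of_opNorm_le _ (hC n) _)
            (norm_nonneg _))
    _ = C * (‖ξ i‖ * ‖η i‖) := by ring
    _ ≤ _ := by
      gcongr
      nlinarith [sq_nonneg (‖ξ i‖ - ‖η i‖), sq_nonneg ‖ξ i‖, sq_nonneg ‖η i‖]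

theorem IsNormal.isWeakLimit {f : Module.End ℂ (Elt A)} (hf : IsNormal f) {s : ℕ → Elt A}
    {a : Elt A} {C : ℝ} (hC : ∀ n, ‖s n‖ ≤ C) (h : IsWeakLimit s a) :
    IsWeakLimit (fun n => f (s n)) (f a) :=
  fun g k => (hf _ (isNormalFunctional_inner g k)).tendsto hC h

theorem IsNormal.pow {f : Module.End ℂ (Elt A)} (hf : IsNormal f) (n : ℕ) : IsNormal (f ^ n) := by
  induction n with
  | zero => exact fun ψ hψ => hψ
  | succ n ih => exact fun ψ hψ => hf _ (ih ψ hψ)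

theorem pow_apply_of_mem_eig {f : Module.End ℂ (Elt A)} {μ : Circle} {x : Elt A}
    (hx : x ∈ eig f μ) (n : ℕ) : (f ^ n) x = (μ : ℂ) ^ n • x := by
  induction n with
  | zero => simp
  | succ n ih =>
    rw [pow_succ', Module.End.mul_apply, ih, map_smul, Module.End.mem_eigenspace_iff.1 hx,
      smul_smul, pow_succ]

theorem pow_defect_self {τ : Module.End ℂ (Elt A)} {ν : Circle} {y : Elt A} (hy : y ∈ eig τ ν) (n m : ℕ) :
    (τ ^ n) (defect (τ ^ m) y y) = (τ ^ (n + m)) (star y * y) - (τ ^ n) (star y * y) := by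
  have h1 : star ((ν : ℂ) ^ m) * (ν : ℂ) ^ m = 1 := by
    rw [← Circle.coe_pow, RCLike.star_def, ← Circle.coe_inv_eq_conj, ← Circle.coe_mul]; simp
  rw [defect, map_sub, pow_apply_of_mem_eig hy, star_smul, smul_mul_smul_comm, h1, one_smul,
    pow_add, Module.End.mul_apply]

/-- A normal unital completely positive map. -/
structure IsNormalUCP (τ : Module.End ℂ (Elt A)) : Prop where
  cp : PreservesMatrixNonneg τ
  one : τ 1 = 1
  normal : IsNormal τ

namespace IsNormalUCP

variable {τ : Module.End ℂ (Elt A)} (hτ : IsNormalUCP τ) {μ ν κ : Circle} {x y w : Elt A}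

include hτ

theorem pow (n : ℕ) : IsNormalUCP (τ ^ n) :=
  ⟨hτ.cp.pow n, pow_one_eq hτ.one n, hτ.normal.pow n⟩

theorem one_mem : (1 : Elt A) ∈ eig τ 1 := by
  rw [Module.End.mem_eigenspace_iff, hτ.one]; simp

theorem star_mem (hx : x ∈ eig τ μ) : star x ∈ eig τ μ⁻¹ := by
  rw [Module.End.mem_eigenspace_iff] at hx ⊢
  rw [map_star_of_preserves hτ.cp, hx, star_smul, Circle.coe_inv_eq_conj]
  rfl

theorem inner_pow_monotone (hy : y ∈ eig τ ν) (k : H) :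
    Monotone (fun n => (⟪k, ((τ ^ n) (star y * y) : H →L[ℂ] H) k⟫_ℂ).re) := by
  refine monotone_nat_of_le_succ fun n => ?_
  have h := inner_map_defect_nonneg (hτ.pow n).cp (hτ.pow 1).cp (hτ.pow 1).one y k
  rw [pow_defect_self hy] at h
  have h4 : (((τ ^ (n + 1)) (star y * y) - (τ ^ n) (star y * y) : Elt A) : H →L[ℂ] H) k =
    ((τ ^ (n + 1)) (star y * y) : H →L[ℂ] H) k - ((τ ^ n) (star y * y) : H →L[ℂ] H) k := rfl
  rw [h4, inner_sub_right, Complex.sub_re] at h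
  linarith

theorem inner_pow_le (y : Elt A) (k : H) (n : ℕ) :
    (⟪k, ((τ ^ n) (star y * y) : H →L[ℂ] H) k⟫_ℂ).re ≤ ‖y‖ ^ 2 * ‖k‖ ^ 2 :=
  inner_map_star_mul_self_le (hτ.pow n).cp (hτ.pow n).one y k

theorem inner_defect_le_left (hx : x ∈ eig τ μ) (y : Elt A) (g k : H) (n m : ℕ) :
    ‖⟪g, ((τ ^ n) (defect (τ ^ m) x y) : H →L[ℂ] H) k⟫_ℂ‖ ^ 2 ≤
      ((⟪g, ((τ ^ (n + m)) (star x * x) : H →L[ℂ] H) g⟫_ℂ).re -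
        (⟪g, ((τ ^ n) (star x * x) : H →L[ℂ] H) g⟫_ℂ).re) * (‖y‖ ^ 2 * ‖k‖ ^ 2) := by
  have h1 := inner_map_defect_sq_le (hτ.pow n).cp (hτ.pow m).cp (hτ.pow m).one x y g k
  have h2 := inner_map_defect_le (hτ.pow n).cp (hτ.pow n).one (hτ.pow m).cp (hτ.pow m).one y k
  have h3 := inner_map_defect_nonneg (hτ.pow n).cp (hτ.pow m).cp (hτ.pow m).one x g
  have h4 : (⟪g, ((τ ^ n) (defect (τ ^ m) x x) : H →L[ℂ] H) g⟫_ℂ).re =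
      (⟪g, ((τ ^ (n + m)) (star x * x) : H →L[ℂ] H) g⟫_ℂ).re -
        (⟪g, ((τ ^ n) (star x * x) : H →L[ℂ] H) g⟫_ℂ).re := by
    rw [pow_defect_self hx, ← Complex.sub_re, ← inner_sub_right]; rfl
  rw [h4] at h1 h3
  exact h1.trans (mul_le_mul_of_nonneg_left h2 h3)

theorem inner_defect_le_right (x : Elt A) (hy : y ∈ eig τ ν) (g k : H) (n m : ℕ) :
    ‖⟪g, ((τ ^ n) (defect (τ ^ m) x y) : H →L[ℂ] H) k⟫_ℂ‖ ^ 2 ≤ (‖x‖ ^ 2 * ‖g‖ ^ 2) *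
      ((⟪k, ((τ ^ (n + m)) (star y * y) : H →L[ℂ] H) k⟫_ℂ).re -
        (⟪k, ((τ ^ n) (star y * y) : H →L[ℂ] H) k⟫_ℂ).re) := by
  have h1 := inner_map_defect_sq_le (hτ.pow n).cp (hτ.pow m).cp (hτ.pow m).one x y g k
  have h2 := inner_map_defect_le (hτ.pow n).cp (hτ.pow n).one (hτ.pow m).cp (hτ.pow m).one x g
  have h3 := inner_map_defect_nonneg (hτ.pow n).cp (hτ.pow m).cp (hτ.pow m).one y k
  have h4 : (⟪k, ((τ ^ n) (defect (τ ^ m) y y) : H →L[ℂ] H) k⟫_ℂ).re =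
      (⟪k, ((τ ^ (n + m)) (star y * y) : H →L[ℂ] H) k⟫_ℂ).re -
        (⟪k, ((τ ^ n) (star y * y) : H →L[ℂ] H) k⟫_ℂ).re := by
    rw [pow_defect_self hy, ← Complex.sub_re, ← inner_sub_right]; rfl
  rw [h4] at h1 h3
  exact h1.trans (mul_le_mul_of_nonneg_right h2 h3)

theorem defect_star_left (hx : x ∈ eig τ μ) (b : Elt A) (m : ℕ) :
    defect (τ ^ m) (star x) b = (τ ^ m) (x * b) - (μ : ℂ) ^ m • (x * (τ ^ m) b) := by
  rw [defect, star_star, map_star_of_preserves (hτ.pow m).cp, star_star, pow_apply_of_mem_eig hx,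
    smul_mul_assoc]

theorem rotated_add_sub (hx : x ∈ eig τ μ) (hy : y ∈ eig τ ν) (n m : ℕ) :
    rotated τ μ ν x y (n + m) - rotated τ μ ν x y n =
      (((μ * ν)⁻¹ ^ (n + m) : Circle) : ℂ) • (τ ^ n) (defect (τ ^ m) (star x) y) := by
  have h1 : (((μ * ν)⁻¹ ^ (n + m) : Circle) : ℂ) * ((μ : ℂ) ^ m * (ν : ℂ) ^ m) =
      (((μ * ν)⁻¹ ^ n : Circle) : ℂ) := by
    rw [← mul_pow, ← Circle.coe_mul, ← Circle.coe_pow, ← Circle.coe_mul, pow_add, mul_assoc,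
      ← mul_pow]
    simp
  rw [hτ.defect_star_left hx, pow_apply_of_mem_eig hy, mul_smul_comm, smul_smul, map_sub,
    map_smul, smul_sub, smul_smul, h1, ← Module.End.mul_apply, ← pow_add]
  rfl

theorem exists_isStrongLimit_rotated (hx : x ∈ eig τ μ) (hy : y ∈ eig τ ν) :
    ∃ z, IsStrongLimit (rotated τ μ ν x y) z := by
  refine exists_isStrongLimit fun k => ?_
  refine cauchySeq_of_norm_sq_sub_le (C := ‖x‖ ^ 2) (by positivity) (hτ.inner_pow_monotone hy k)
    (hτ.inner_pow_le y k) fun n m => ?_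
  set v := (rotated τ μ ν x y (n + m) : H →L[ℂ] H) k - (rotated τ μ ν x y n : H →L[ℂ] H) k
    with hv
  have h1 : v = (((μ * ν)⁻¹ ^ (n + m) : Circle) : ℂ) •
      (((τ ^ n) (defect (τ ^ m) (star x) y) : Elt A) : H →L[ℂ] H) k := by
    have := congrArg (fun a : Elt A => (a : H →L[ℂ] H) k) (hτ.rotated_add_sub hx hy n m)
    exact this
  have h2 := hτ.inner_defect_le_right (star x) hy v k n m
  have h3 : ‖⟪v, v⟫_ℂ‖ = ‖⟪v, ((τ ^ n) (defect (τ ^ m) (star x) y) : H →L[ℂ] H) k⟫_ℂ‖ := by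
    conv_lhs => rw [h1, inner_smul_right, norm_mul, Circle.norm_coe, one_mul, ← h1]
  rw [← h3, inner_self_eq_norm_sq_to_K, norm_pow, norm_star] at h2
  change (‖((‖v‖ : ℝ) : ℂ)‖ ^ 2) ^ 2 ≤ _ at h2
  rw [Complex.norm_real, norm_norm] at h2
  rcases eq_or_ne v 0 with h0 | h0
  · rw [h0, norm_zero, zero_pow two_ne_zero]
    exact mul_nonneg (by positivity)
      (sub_nonneg.2 (hτ.inner_pow_monotone hy k (Nat.le_add_right n m)))
  · have h4 : 0 < ‖v‖ ^ 2 := by positivity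
    refine le_of_mul_le_mul_right ?_ h4
    linarith

theorem isStrongLimit_pmul (hx : x ∈ eig τ μ) (hy : y ∈ eig τ ν) :
    IsStrongLimit (rotated τ μ ν x y) (pmul τ x y) := by
  obtain ⟨z, hz⟩ := hτ.exists_isStrongLimit_rotated hx hy
  obtain ⟨μ', ν', hx', hy', h'⟩ := Classical.epsilon_spec (p := fun z => ∃ μ ν : Circle,
    x ∈ eig τ μ ∧ y ∈ eig τ ν ∧ IsStrongLimit (rotated τ μ ν x y) z) ⟨z, μ, ν, hx, hy, hz⟩
  change IsStrongLimit (rotated τ μ' ν' x y) (pmul τ x y) at h'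
  have key : ∀ {u : Elt A} {α β : Circle}, u ∈ eig τ α → u ∈ eig τ β → u ≠ 0 → α = β := by
    intro u α β h1 h2 h0
    rw [Module.End.mem_eigenspace_iff] at h1 h2
    exact Circle.ext (smul_left_injective ℂ h0 (h1.symm.trans h2))
  by_cases h : x * y = 0
  · have : rotated τ μ ν x y = rotated τ μ' ν' x y := by
      funext n; simp [rotated, h]
    rwa [this]
  · rw [key hx hx' (left_ne_zero_of_mul h), key hy hy' (right_ne_zero_of_mul h)]
    exact h'

theorem pmul_eq_of_isWeakLimit (hx : x ∈ eig τ μ) (hy : y ∈ eig τ ν) {z : Elt A}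
    (hz : IsWeakLimit (rotated τ μ ν x y) z) : pmul τ x y = z :=
  (hτ.isStrongLimit_pmul hx hy).isWeakLimit.unique hz

theorem norm_rotated_le (μ ν : Circle) (x y : Elt A) (n : ℕ) :
    ‖rotated τ μ ν x y n‖ ≤ ‖x * y‖ := by
  rw [rotated, norm_smul, Circle.norm_coe, one_mul]
  exact norm_map_le (hτ.pow n).cp (hτ.pow n).one _

theorem pmul_mem (hx : x ∈ eig τ μ) (hy : y ∈ eig τ ν) : pmul τ x y ∈ eig τ (μ * ν) := by
  rw [Module.End.mem_eigenspace_iff]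
  have h := (hτ.isStrongLimit_pmul hx hy)
  have h1 := hτ.normal.isWeakLimit (hτ.norm_rotated_le μ ν x y) h.isWeakLimit
  have h2 : IsStrongLimit (fun n => ((μ * ν : Circle) : ℂ) • rotated τ μ ν x y (n + 1))
      (((μ * ν : Circle) : ℂ) • pmul τ x y) :=
    IsStrongLimit.smul _ fun k => (tendsto_add_atTop_iff_nat 1).2 (h k)
  refine h1.unique ?_
  convert h2.isWeakLimit using 2 with n
  rw [rotated, rotated, map_smul, smul_smul, ← Circle.coe_mul, pow_succ', mul_inv_cancel_left,
    pow_succ', Module.End.mul_apply]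

theorem star_pmul (hx : x ∈ eig τ μ) (hy : y ∈ eig τ ν) :
    star (pmul τ x y) = pmul τ (star y) (star x) := by
  refine (hτ.pmul_eq_of_isWeakLimit (hτ.star_mem hy) (hτ.star_mem hx) ?_).symm
  convert (hτ.isStrongLimit_pmul hx hy).isWeakLimit.star using 2 with n
  rw [rotated, rotated, star_smul, ← map_star_of_preserves (hτ.pow n).cp, star_mul,
    RCLike.star_def, ← Circle.coe_inv_eq_conj, ← inv_pow, mul_inv μ ν, mul_comm μ⁻¹, mul_inv]

theorem pmul_one (hx : x ∈ eig τ μ) : pmul τ x 1 = x := by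
  refine hτ.pmul_eq_of_isWeakLimit hx hτ.one_mem ?_
  have : rotated τ μ 1 x 1 = fun _ => x := by
    funext n
    rw [rotated, mul_one, mul_one, pow_apply_of_mem_eig hx, smul_smul, ← Circle.coe_pow,
      ← Circle.coe_mul, ← mul_pow]
    simp
  rw [this]
  exact fun _ _ => tendsto_const_nhds

theorem one_pmul (hx : x ∈ eig τ μ) : pmul τ 1 x = x := by
  have := hτ.star_pmul (hτ.star_mem hx) hτ.one_mem
  rw [hτ.pmul_one (hτ.star_mem hx), star_star, star_one] at this
  exact this.symm

/-- The triple product is the weak limit of the rotated iterates of the ordinary product. -/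
theorem isWeakLimit_triple (hx : x ∈ eig τ μ) (hy : y ∈ eig τ ν) (hw : w ∈ eig τ κ) :
    IsWeakLimit (fun n => (((μ * (ν * κ))⁻¹ ^ n : Circle) : ℂ) • (τ ^ n) (x * (y * w)))
      (pmul τ x (pmul τ y w)) := by
  intro g k
  have hz := hτ.isStrongLimit_pmul hy hw
  have hsx := hτ.star_mem hx
  set q : ℕ → ℝ := fun n => (⟪g, ((τ ^ n) (star (star x) * star x) : H →L[ℂ] H) g⟫_ℂ).re with hq
  have hqm : Monotone q := hτ.inner_pow_monotone hsx g
  obtain ⟨l, hl⟩ := (tendsto_atTop_of_monotone hqm).resolve_left fun h' =>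
    (h'.eventually_gt_atTop _).exists.elim fun n hn =>
      absurd (hτ.inner_pow_le (star x) g n) (not_le.2 hn)
  have hql : ∀ n, q n ≤ l := hqm.ge_of_tendsto hl
  refine tendsto_of_approx (e := fun n => √((l - q n) * (‖y * w‖ ^ 2 * ‖k‖ ^ 2)))
    (u := fun n => ⟪g, (rotated τ μ (ν * κ) x (pmul τ y w) n : H →L[ℂ] H) k⟫_ℂ)
    (U := fun n m => ⟪g, (rotated τ μ (ν * κ) x (rotated τ ν κ y w m) n : H →L[ℂ] H) k⟫_ℂ)
    ?_ ((hτ.isStrongLimit_pmul hx (hτ.pmul_mem hy hw)).isWeakLimit g k) (fun n => ?_)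
    fun n m => ?_
  · have : Tendsto (fun n => √((l - q n) * (‖y * w‖ ^ 2 * ‖k‖ ^ 2))) atTop
        (𝓝 √((l - l) * (‖y * w‖ ^ 2 * ‖k‖ ^ 2))) :=
      ((tendsto_const_nhds.sub hl).mul_const _).sqrt
    simpa using this
  · have h1 : IsStrongLimit (fun m => x * rotated τ ν κ y w m) (x * pmul τ y w) :=
      IsStrongLimit.mul (s := fun _ => x) (fun _ => le_rfl) (fun _ => tendsto_const_nhds) hz
    have h2 : ∀ m, ‖x * rotated τ ν κ y w m‖ ≤ ‖x‖ * ‖y * w‖ := fun m =>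
      (norm_mul_le _ _).trans
        (mul_le_mul_of_nonneg_left (hτ.norm_rotated_le ν κ y w m) (norm_nonneg _))
    exact IsWeakLimit.smul _ ((hτ.pow n).normal.isWeakLimit h2 h1.isWeakLimit) g k
  · have h1 : (((μ * (ν * κ))⁻¹ ^ (n + m) : Circle) : ℂ) • (τ ^ (n + m)) (x * (y * w)) -
        rotated τ μ (ν * κ) x (rotated τ ν κ y w m) n =
        (((μ * (ν * κ))⁻¹ ^ (n + m) : Circle) : ℂ) •
          (τ ^ n) (defect (τ ^ m) (star x) (y * w)) := by
      have h2 : (((μ * (ν * κ))⁻¹ ^ (n + m) : Circle) : ℂ) * (μ : ℂ) ^ m =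
          (((μ * (ν * κ))⁻¹ ^ n : Circle) : ℂ) * (((ν * κ)⁻¹ ^ m : Circle) : ℂ) := by
        rw [← Circle.coe_pow, ← Circle.coe_mul, ← Circle.coe_mul, pow_add, mul_assoc, ← mul_pow,
          mul_inv μ, mul_comm μ⁻¹, inv_mul_cancel_right]
      rw [hτ.defect_star_left hx, map_sub, map_smul, smul_sub, smul_smul, h2, rotated, rotated,
        mul_smul_comm, map_smul, smul_smul, ← Module.End.mul_apply, ← pow_add]
    have h2 := hτ.inner_defect_le_left hsx (y * w) g k n m
    rw [← inner_sub_right]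
    have h3 : ((((((μ * (ν * κ))⁻¹ ^ (n + m) : Circle) : ℂ) • (τ ^ (n + m)) (x * (y * w)) : Elt A)
        : H →L[ℂ] H) k - (rotated τ μ (ν * κ) x (rotated τ ν κ y w m) n : H →L[ℂ] H) k) =
        (((μ * (ν * κ))⁻¹ ^ (n + m) : Circle) : ℂ) •
          (((τ ^ n) (defect (τ ^ m) (star x) (y * w)) : Elt A) : H →L[ℂ] H) k :=
      congrArg (fun a : Elt A => (a : H →L[ℂ] H) k) h1
    rw [h3, inner_smul_right, norm_mul, Circle.norm_coe, one_mul]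
    refine Real.le_sqrt_of_sq_le (h2.trans ?_)
    gcongr
    exact hql _

theorem pmul_assoc (hx : x ∈ eig τ μ) (hy : y ∈ eig τ ν) (hw : w ∈ eig τ κ) :
    pmul τ (pmul τ x y) w = pmul τ x (pmul τ y w) := by
  have h1 := hτ.isWeakLimit_triple hx hy hw
  have h2 := (hτ.isWeakLimit_triple (hτ.star_mem hw) (hτ.star_mem hy) (hτ.star_mem hx)).star
  rw [← hτ.star_pmul hx hy, ← hτ.star_pmul (hτ.pmul_mem hx hy) hw, star_star] at h2
  refine h2.unique ?_
  convert h1 using 2 with n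
  rw [star_smul, ← map_star_of_preserves (hτ.pow n).cp, star_mul, star_mul, star_star, star_star,
    star_star, mul_assoc, RCLike.star_def, ← Circle.coe_inv_eq_conj, ← inv_pow]
  congr 3
  simp [mul_comm, mul_left_comm]

theorem pmul_add (hx : x ∈ eig τ μ) (hy : y ∈ eig τ ν) (hw : w ∈ eig τ ν) :
    pmul τ x (y + w) = pmul τ x y + pmul τ x w := by
  refine hτ.pmul_eq_of_isWeakLimit hx (add_mem hy hw) (IsStrongLimit.isWeakLimit ?_)
  convert (hτ.isStrongLimit_pmul hx hy).add (hτ.isStrongLimit_pmul hx hw) using 2 with n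
  simp only [rotated, mul_add, map_add, smul_add]

theorem pmul_smul (c : ℂ) (hx : x ∈ eig τ μ) (hy : y ∈ eig τ ν) :
    pmul τ x (c • y) = c • pmul τ x y := by
  refine hτ.pmul_eq_of_isWeakLimit hx (Submodule.smul_mem _ c hy) (IsStrongLimit.isWeakLimit ?_)
  convert (hτ.isStrongLimit_pmul hx hy).smul c using 2 with n
  simp only [rotated, mul_smul_comm, map_smul, smul_comm c]

theorem add_pmul (hx : x ∈ eig τ μ) (hw : w ∈ eig τ μ) (hy : y ∈ eig τ ν) :
    pmul τ (x + w) y = pmul τ x y + pmul τ w y := by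
  refine hτ.pmul_eq_of_isWeakLimit (add_mem hx hw) hy (IsStrongLimit.isWeakLimit ?_)
  convert (hτ.isStrongLimit_pmul hx hy).add (hτ.isStrongLimit_pmul hw hy) using 2 with n
  simp only [rotated, add_mul, map_add, smul_add]

theorem smul_pmul (c : ℂ) (hx : x ∈ eig τ μ) (hy : y ∈ eig τ ν) :
    pmul τ (c • x) y = c • pmul τ x y := by
  refine hτ.pmul_eq_of_isWeakLimit (Submodule.smul_mem _ c hx) hy (IsStrongLimit.isWeakLimit ?_)
  convert (hτ.isStrongLimit_pmul hx hy).smul c using 2 with n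
  simp only [rotated, smul_mul_assoc, map_smul, smul_comm c]

end IsNormalUCP

end Limits

end PeripheralPoisson

/-- Some ultrafilter finer than `atTop` makes `μ ^ n` tend to `1` for all `μ` on the circle. -/
theorem Circle.exists_ultrafilter_tendsto_pow :
    ∃ U : Ultrafilter ℕ, ↑U ≤ (atTop : Filter ℕ) ∧
      ∀ μ : Circle, Tendsto (fun n : ℕ => μ ^ n) U (𝓝 1) := by
  obtain ⟨U, hU, h⟩ := mapClusterPt_iff_ultrafilter.1
    (mapClusterPt_one_atTop_pow (id : Circle → Circle))
  exact ⟨U, hU, fun μ => (tendsto_pi_nhds.1 h) μ⟩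

theorem cauchySeq_apply_of_dense {E F : Type*} [NormedAddCommGroup E] [NormedSpace ℂ E]
    [NormedAddCommGroup F] [NormedSpace ℂ F] {s : ℕ → E →L[ℂ] F} {C : ℝ} (hC : ∀ n, ‖s n‖ ≤ C)
    {S : Set E} (hS : Dense S) (h : ∀ k ∈ S, CauchySeq fun n => s n k) (k : E) :
    CauchySeq fun n => s n k := by
  rw [Metric.cauchySeq_iff]
  intro ε hε
  have hC0 : 0 ≤ C := (norm_nonneg _).trans (hC 0)
  obtain ⟨k', hk', hd⟩ := Metric.dense_iff.1 hS k (ε / (3 * (C + 1))) (by positivity)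
  obtain ⟨N, hN⟩ := Metric.cauchySeq_iff.1 (h k' hd) (ε / 3) (by positivity)
  have h1 : ∀ n, dist (s n k) (s n k') < ε / 3 := by
    intro n
    rw [dist_eq_norm, ← map_sub]
    rw [Metric.mem_ball, dist_comm, dist_eq_norm] at hk'
    calc ‖s n (k - k')‖ ≤ C * ‖k - k'‖ := ContinuousLinearMap.le_of_opNorm_le _ (hC n) _
      _ ≤ (C + 1) * ‖k - k'‖ := by gcongr; linarith
      _ < (C + 1) * (ε / (3 * (C + 1))) := by gcongr
      _ = ε / 3 := by field_simp
  refine ⟨N, fun m hm n hn => ?_⟩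
  calc dist (s m k) (s n k) ≤ dist (s m k) (s m k') + dist (s m k') (s n k') +
        dist (s n k') (s n k) := dist_triangle4 _ _ _ _
    _ < ε / 3 + ε / 3 + ε / 3 := by
      have := h1 n
      rw [dist_comm] at this
      exact add_lt_add (add_lt_add (h1 m) (hN m hm n hn)) this
    _ = ε := by ring

namespace PeripheralPoisson

section StarEndomorphism

variable {K : Type v} [NormedAddCommGroup K] [InnerProductSpace ℂ K] [CompleteSpace K]
variable {B : VonNeumannAlgebra K} (θ : Elt B →⋆ₐ[ℂ] Elt B)

theorem pow_map_mul (n : ℕ) (a b : Elt B) : (θ.toAlgHom.toLinearMap ^ n) (a * b) =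
    (θ.toAlgHom.toLinearMap ^ n) a * (θ.toAlgHom.toLinearMap ^ n) b := by
  induction n with
  | zero => rfl
  | succ n ih =>
    simp only [pow_succ', Module.End.mul_apply, ih]
    exact map_mul θ _ _

theorem pow_map_star (n : ℕ) (a : Elt B) : (θ.toAlgHom.toLinearMap ^ n) (star a) =
    star ((θ.toAlgHom.toLinearMap ^ n) a) := by
  induction n with
  | zero => rfl
  | succ n ih =>
    simp only [pow_succ', Module.End.mul_apply, ih]
    exact map_star θ _

theorem norm_pow_map_le (n : ℕ) (a : Elt B) : ‖(θ.toAlgHom.toLinearMap ^ n) a‖ ≤ ‖a‖ := by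
  induction n with
  | zero => exact le_rfl
  | succ n ih =>
    rw [pow_succ', Module.End.mul_apply]
    exact (NonUnitalStarAlgHom.norm_apply_le θ _).trans ih

/-- The elements of the peripheral space of a `*`-endomorphism return along a common ultrafilter. -/
theorem tendsto_pow_of_mem_peripheralSpace {U : Ultrafilter ℕ}
    (hU : ∀ μ : Circle, Tendsto (fun n : ℕ => μ ^ n) U (𝓝 1)) {z : Elt B}
    (hz : z ∈ peripheralSpace θ.toAlgHom.toLinearMap) :
    Tendsto (fun n => (θ.toAlgHom.toLinearMap ^ n) z) U (𝓝 z) := by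
  have h1 : ∀ w ∈ ⨆ μ : Circle, eig θ.toAlgHom.toLinearMap μ,
      Tendsto (fun n => (θ.toAlgHom.toLinearMap ^ n) w) U (𝓝 w) := by
    intro w hw
    refine Submodule.iSup_induction _ (motive := fun w =>
      Tendsto (fun n => (θ.toAlgHom.toLinearMap ^ n) w) U (𝓝 w)) hw (fun μ w hw => ?_) ?_ ?_
    · simp only [pow_apply_of_mem_eig hw]
      have h2 : Tendsto (fun n : ℕ => ((μ ^ n : Circle) : ℂ)) U (𝓝 ((1 : Circle) : ℂ)) :=
        ((continuous_subtype_val (p := fun z : ℂ => z ∈ Submonoid.unitSphere ℂ)).tendsto 1).comp (hU μ)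
      simpa using h2.smul_const w
    · simp
    · intro a b ha hb
      simpa using ha.add hb
  rw [Metric.tendsto_nhds]
  intro ε hε
  obtain ⟨w, hw, hd⟩ := Metric.mem_closure_iff.1
    (show z ∈ closure ((⨆ μ : Circle, eig θ.toAlgHom.toLinearMap μ : Submodule ℂ (Elt B)) :
      Set (Elt B)) from hz) (ε / 3) (by positivity)
  filter_upwards [Metric.tendsto_nhds.1 (h1 w hw) (ε / 3) (by positivity)] with n hn
  calc dist ((θ.toAlgHom.toLinearMap ^ n) z) z
      ≤ dist ((θ.toAlgHom.toLinearMap ^ n) z) ((θ.toAlgHom.toLinearMap ^ n) w) +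
        dist ((θ.toAlgHom.toLinearMap ^ n) w) w + dist w z := dist_triangle4 _ _ _ _
    _ < ε / 3 + ε / 3 + ε / 3 := by
      have h3 : dist ((θ.toAlgHom.toLinearMap ^ n) z) ((θ.toAlgHom.toLinearMap ^ n) w) < ε / 3 := by
        rw [dist_eq_norm, ← map_sub]
        rw [dist_eq_norm] at hd
        exact (norm_pow_map_le θ n _).trans_lt hd
      rw [dist_comm w z]
      gcongr
    _ = ε := by ring

end StarEndomorphism

namespace MinimalDilation

variable {H : Type u} [NormedAddCommGroup H] [InnerProductSpace ℂ H] [CompleteSpace H]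
variable {K : Type v} [NormedAddCommGroup K] [InnerProductSpace ℂ K] [CompleteSpace K]
variable {A : VonNeumannAlgebra H} {τ : Module.End ℂ (Elt A)} (D : MinimalDilation τ K)

/-- The dilated dynamics as a linear map. -/
noncomputable abbrev endo : Module.End ℂ (Elt D.B) := D.θ.toAlgHom.toLinearMap

/-- The inclusion of `A` in `B`. -/
noncomputable def incl (a : Elt A) : Elt D.B := ⟨_, D.amplify_mem a⟩

theorem incl_apply (a : Elt A) (k : K) : (D.incl a : K →L[ℂ] K) k =
    D.V ((a : H →L[ℂ] H) (ContinuousLinearMap.adjoint D.V.toContinuousLinearMap k)) := rfl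

theorem T_apply (b : Elt D.B) (h : H) : (D.T b : H →L[ℂ] H) h =
    ContinuousLinearMap.adjoint D.V.toContinuousLinearMap ((b : K →L[ℂ] K) (D.V h)) := rfl

theorem adjoint_V_V (h : H) :
    ContinuousLinearMap.adjoint D.V.toContinuousLinearMap (D.V h) = h := by
  refine ext_inner_left ℂ fun g => ?_
  rw [ContinuousLinearMap.adjoint_inner_right]
  exact D.V.inner_map_map g h

theorem incl_mul (a b : Elt A) : D.incl (a * b) = D.incl a * D.incl b := by
  refine elt_ext fun k => ?_
  change _ = (D.incl a : K →L[ℂ] K) ((D.incl b : K →L[ℂ] K) k)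
  rw [incl_apply, incl_apply, incl_apply, adjoint_V_V]
  rfl

theorem incl_smul (c : ℂ) (a : Elt A) : D.incl (c • a) = c • D.incl a := by
  refine elt_ext fun k => ?_
  change _ = c • (D.incl a : K →L[ℂ] K) k
  rw [incl_apply, incl_apply, ← map_smul]
  rfl

theorem star_incl_one : star (D.incl 1) = D.incl 1 := by
  refine elt_ext fun k => ext_inner_left ℂ fun g => ?_
  rw [inner_star_apply, incl_apply, incl_apply]
  change ⟪D.V.toContinuousLinearMap (ContinuousLinearMap.adjoint D.V.toContinuousLinearMap g), k⟫_ℂ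
    = ⟪g, D.V.toContinuousLinearMap (ContinuousLinearMap.adjoint D.V.toContinuousLinearMap k)⟫_ℂ
  rw [← ContinuousLinearMap.adjoint_inner_right, ContinuousLinearMap.adjoint_inner_left,
    ← ContinuousLinearMap.adjoint_inner_left]

theorem incl_T (b : Elt D.B) : D.incl (D.T b) = D.incl 1 * b * D.incl 1 := by
  refine elt_ext fun k => ?_
  change _ = (D.incl 1 : K →L[ℂ] K) ((b : K →L[ℂ] K) ((D.incl 1 : K →L[ℂ] K) k))
  rw [incl_apply, incl_apply, incl_apply, T_apply]
  rfl

theorem T_sub (a b : Elt D.B) : D.T (a - b) = D.T a - D.T b := by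
  refine elt_ext fun h => ?_
  change _ = (D.T a : H →L[ℂ] H) h - (D.T b : H →L[ℂ] H) h
  rw [T_apply, T_apply, T_apply, ← map_sub]
  rfl

theorem T_smul (c : ℂ) (a : Elt D.B) : D.T (c • a) = c • D.T a := by
  refine elt_ext fun h => ?_
  change _ = c • (D.T a : H →L[ℂ] H) h
  rw [T_apply, T_apply, ← map_smul]
  rfl

theorem T_pow_incl (n : ℕ) (a : Elt A) : D.T ((D.endo ^ n) (D.incl a)) = (τ ^ n) a :=
  Subtype.ext (D.dilates n a).symm

theorem isStrongLimit_T {s : ℕ → Elt D.B} {b : Elt D.B} (h : IsStrongLimit s b) :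
    IsStrongLimit (fun n => D.T (s n)) (D.T b) := by
  intro k
  simp only [T_apply]
  exact ((ContinuousLinearMap.continuous _).tendsto _).comp (h (D.V k))

/-- The increasing projections `θⁿ(p)`. -/
noncomputable def proj (n : ℕ) : Elt D.B := (D.endo ^ n) (D.incl 1)

theorem star_proj (n : ℕ) : star (D.proj n) = D.proj n := by
  rw [proj, ← pow_map_star, star_incl_one]

theorem proj_mul_pow_incl (n : ℕ) (a : Elt A) :
    D.proj n * (D.endo ^ n) (D.incl a) = (D.endo ^ n) (D.incl a) := by
  rw [proj, ← pow_map_mul, ← incl_mul, one_mul]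

theorem proj_mul_self (n : ℕ) : D.proj n * D.proj n = D.proj n := D.proj_mul_pow_incl n 1

theorem norm_proj_le (n : ℕ) : ‖D.proj n‖ ≤ 1 := by
  have h := CStarRing.norm_star_mul_self (x := D.proj n)
  rw [star_proj, proj_mul_self] at h
  nlinarith [norm_nonneg (D.proj n)]

theorem proj_mul_mul_proj (n : ℕ) (b : Elt D.B) :
    D.proj n * (D.endo ^ n) b * D.proj n = (D.endo ^ n) (D.incl (D.T b)) := by
  rw [proj, incl_T, pow_map_mul, pow_map_mul]

theorem proj_add_mul (hone : τ 1 = 1) (n m : ℕ) : D.proj (n + m) * D.proj n = D.proj n := by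
  set p := D.incl 1 with hp
  have hpp : p * p = p := by rw [hp, ← incl_mul, one_mul]
  have hps : star p = p := D.star_incl_one
  have h1 : p * D.proj m * p = p := by
    rw [proj, hp, ← incl_T, T_pow_incl, pow_one_eq hone]
  have h2 : D.proj m * p = p := by
    have h3 : star (p - D.proj m * p) * (p - D.proj m * p) = 0 := by
      rw [star_sub, star_mul, hps, star_proj]
      have h4 : (p - p * D.proj m) * (p - D.proj m * p) =
          p * p - p * D.proj m * p - p * D.proj m * p + p * (D.proj m * D.proj m) * p := by
        noncomm_ring
      rw [h4, proj_mul_self, h1, hpp]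
      simp
    exact (sub_eq_zero.1 (CStarRing.star_mul_self_eq_zero_iff _ |>.1 h3)).symm
  have h5 : D.proj (n + m) = (D.endo ^ n) (D.proj m) := by
    rw [proj, pow_add, Module.End.mul_apply]; rfl
  rw [h5]
  change (D.endo ^ n) (D.proj m) * (D.endo ^ n) p = (D.endo ^ n) p
  rw [← pow_map_mul, h2]

theorem dense_proj_fixed (hone : τ 1 = 1) :
    Dense {k : K | ∃ N, ∀ n ≥ N, (D.proj n : K →L[ℂ] K) k = k} := by
  let S : Submodule ℂ K :=
    { carrier := {k : K | ∃ N, ∀ n ≥ N, (D.proj n : K →L[ℂ] K) k = k}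
      zero_mem' := ⟨0, fun n _ => map_zero _⟩
      add_mem' := by
        rintro a b ⟨N, hN⟩ ⟨M, hM⟩
        refine ⟨max N M, fun n hn => ?_⟩
        rw [map_add, hN n (le_of_max_le_left hn), hM n (le_of_max_le_right hn)]
      smul_mem' := by
        rintro c a ⟨N, hN⟩
        refine ⟨N, fun n hn => ?_⟩
        rw [map_smul, hN n hn] }
  have hS : Submodule.span ℂ {k : K | ∃ (n : ℕ) (x : ℕ → Elt A) (h : H),
      k = word D.V (fun a => (⟨_, D.amplify_mem a⟩ : Elt D.B)) D.θ.toAlgHom.toLinearMap x h n}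
      ≤ S := by
    rw [Submodule.span_le]
    rintro k ⟨n, x, h, rfl⟩
    have h1 : (D.proj n : K →L[ℂ] K) (word D.V (fun a => (⟨_, D.amplify_mem a⟩ : Elt D.B))
        D.θ.toAlgHom.toLinearMap x h n) = word D.V (fun a => (⟨_, D.amplify_mem a⟩ : Elt D.B))
        D.θ.toAlgHom.toLinearMap x h n := by
      cases n with
      | zero =>
        change (D.incl 1 : K →L[ℂ] K) (D.V h) = D.V h
        rw [incl_apply, adjoint_V_V]
        rfl
      | succ n =>
        exact DFunLike.congr_fun (congrArg (Subtype.val) (D.proj_mul_pow_incl (n + 1) (x n))) _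
    refine ⟨n, fun m hm => ?_⟩
    obtain ⟨r, rfl⟩ := Nat.exists_eq_add_of_le hm
    conv_lhs => rw [← h1]
    conv_rhs => rw [← h1]
    exact DFunLike.congr_fun (congrArg (Subtype.val) (D.proj_add_mul hone n r)) _
  have h2 : S.topologicalClosure = ⊤ :=
    top_le_iff.1 (D.minimal_space.symm.le.trans (Submodule.topologicalClosure_mono hS))
  exact Submodule.dense_iff_topologicalClosure_eq_top.2 h2

theorem isStrongLimit_proj (hone : τ 1 = 1) : IsStrongLimit D.proj 1 := by
  have hd := D.dense_proj_fixed hone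
  have h1 : ∀ k ∈ {k : K | ∃ N, ∀ n ≥ N, (D.proj n : K →L[ℂ] K) k = k},
      Tendsto (fun n => (D.proj n : K →L[ℂ] K) k) atTop (𝓝 k) := by
    rintro k ⟨N, hN⟩
    exact tendsto_const_nhds.congr' (eventually_atTop.2 ⟨N, fun n hn => (hN n hn).symm⟩)
  obtain ⟨Q, hQ⟩ := exists_isStrongLimit (s := D.proj) fun k =>
    cauchySeq_apply_of_dense (s := fun n => (D.proj n : K →L[ℂ] K)) D.norm_proj_le hd
      (fun k hk => (h1 k hk).cauchySeq) k
  have h2 : Q = 1 := by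
    refine Subtype.ext (DFunLike.coe_injective ?_)
    exact Continuous.ext_on hd (Q : K →L[ℂ] K).continuous continuous_id
      fun k hk => tendsto_nhds_unique (hQ k) (h1 k hk)
  rwa [← h2]

theorem norm_sub_proj_sq (n : ℕ) (v : K) : ‖v - (D.proj n : K →L[ℂ] K) v‖ ^ 2 =
    ‖v‖ ^ 2 - ‖(D.proj n : K →L[ℂ] K) v‖ ^ 2 := by
  have h1 : ⟪v, (D.proj n : K →L[ℂ] K) v⟫_ℂ =
      ⟪(D.proj n : K →L[ℂ] K) v, (D.proj n : K →L[ℂ] K) v⟫_ℂ := by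
    rw [← inner_star_apply, star_proj]
    congr 1
    exact (DFunLike.congr_fun (congrArg (Subtype.val) (D.proj_mul_self n)) v).symm
  rw [norm_sub_sq (𝕜 := ℂ), h1, inner_self_eq_norm_sq]
  ring

/-- The sequence `μ⁻ⁿ θⁿ(x)`. -/
noncomputable def orbit (μ : Circle) (x : Elt A) (n : ℕ) : Elt D.B :=
  ((μ⁻¹ ^ n : Circle) : ℂ) • (D.endo ^ n) (D.incl x)

theorem norm_orbit_le (μ : Circle) (x : Elt A) (n : ℕ) : ‖D.orbit μ x n‖ ≤ ‖D.incl x‖ := by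
  rw [orbit, norm_smul, Circle.norm_coe, one_mul]
  exact norm_pow_map_le _ _ _

theorem proj_mul_orbit_mul_proj {μ : Circle} {x : Elt A} (hx : x ∈ eig τ μ) (n m : ℕ) :
    D.proj n * D.orbit μ x (n + m) * D.proj n = D.orbit μ x n := by
  rw [orbit, orbit, pow_add D.endo, Module.End.mul_apply, mul_smul_comm, smul_mul_assoc,
    proj_mul_mul_proj, T_pow_incl, pow_apply_of_mem_eig hx, incl_smul, map_smul, smul_smul]
  congr 1
  rw [← Circle.coe_pow, ← Circle.coe_mul, pow_add, mul_assoc, ← mul_pow]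
  simp

theorem exists_isStrongLimit_orbit (hone : τ 1 = 1) {μ : Circle} {x : Elt A}
    (hx : x ∈ eig τ μ) : ∃ z, IsStrongLimit (D.orbit μ x) z := by
  refine exists_isStrongLimit fun k => cauchySeq_apply_of_dense
    (s := fun n => (D.orbit μ x n : K →L[ℂ] K)) (D.norm_orbit_le μ x) (D.dense_proj_fixed hone)
    ?_ k
  rintro k ⟨N, hN⟩
  have h1 : ∀ n ≥ N, ∀ m, (D.proj n : K →L[ℂ] K) ((D.orbit μ x (n + m) : K →L[ℂ] K) k) =
      (D.orbit μ x n : K →L[ℂ] K) k := by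
    intro n hn m
    have := DFunLike.congr_fun (congrArg (Subtype.val) (D.proj_mul_orbit_mul_proj hx n m)) k
    rw [← this]
    change _ = (D.proj n : K →L[ℂ] K) ((D.orbit μ x (n + m) : K →L[ℂ] K)
      ((D.proj n : K →L[ℂ] K) k))
    rw [hN n hn]
  have h2 : ∀ n ≥ N, ∀ m, ‖(D.orbit μ x (n + m) : K →L[ℂ] K) k -
      (D.orbit μ x n : K →L[ℂ] K) k‖ ^ 2 = ‖(D.orbit μ x (n + m) : K →L[ℂ] K) k‖ ^ 2 -
      ‖(D.orbit μ x n : K →L[ℂ] K) k‖ ^ 2 := by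
    intro n hn m
    rw [← h1 n hn m, norm_sub_proj_sq]
  have h3 : CauchySeq fun n => (D.orbit μ x (N + n) : K →L[ℂ] K) k := by
    refine cauchySeq_of_norm_sq_sub_le (C := 1) (B := (‖D.incl x‖ * ‖k‖) ^ 2)
      (q := fun n => ‖(D.orbit μ x (N + n) : K →L[ℂ] K) k‖ ^ 2) zero_le_one
      (monotone_nat_of_le_succ fun n => ?_) (fun n => ?_) fun n m => ?_
    · have := h2 (N + n) (by omega) 1
      rw [add_assoc] at this
      have h4 := sq_nonneg ‖(D.orbit μ x (N + (n + 1)) : K →L[ℂ] K) k -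
        (D.orbit μ x (N + n) : K →L[ℂ] K) k‖
      linarith
    · gcongr
      exact ContinuousLinearMap.le_of_opNorm_le _ (D.norm_orbit_le μ x _) _
    · rw [one_mul, ← add_assoc, h2 (N + n) (by omega) m]
  simp only [add_comm N] at h3
  exact (cauchySeq_shift N).1 h3

theorem mem_eig_of_isStrongLimit_orbit {μ : Circle} {x : Elt A} {z : Elt D.B}
    (hz : IsStrongLimit (D.orbit μ x) z) : z ∈ eig D.endo μ := by
  rw [Module.End.mem_eigenspace_iff]
  have h1 := D.normal.isWeakLimit (D.norm_orbit_le μ x) hz.isWeakLimit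
  have h2 : IsStrongLimit (fun n => (μ : ℂ) • D.orbit μ x (n + 1)) ((μ : ℂ) • z) :=
    IsStrongLimit.smul _ fun k => (tendsto_add_atTop_iff_nat 1).2 (hz k)
  refine h1.unique ?_
  convert h2.isWeakLimit using 2 with n
  rw [orbit, orbit, map_smul, smul_smul, ← Circle.coe_mul, pow_succ', mul_inv_cancel_left,
    pow_succ', Module.End.mul_apply]

theorem T_eq_of_isStrongLimit_orbit {μ : Circle} {x : Elt A} (hx : x ∈ eig τ μ) {z : Elt D.B}
    (hz : IsStrongLimit (D.orbit μ x) z) : D.T z = x := by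
  refine (D.isStrongLimit_T hz).unique ?_
  have : (fun n => D.T (D.orbit μ x n)) = fun _ => x := by
    funext n
    rw [orbit, T_smul, T_pow_incl, pow_apply_of_mem_eig hx, smul_smul, ← Circle.coe_pow,
      ← Circle.coe_mul, ← mul_pow]
    simp
  rw [this]
  exact fun _ => tendsto_const_nhds

theorem eq_zero_of_T_eq_zero (hone : τ 1 = 1) {z : Elt D.B} (hz : z ∈ peripheralSpace D.endo)
    (h0 : D.T z = 0) : z = 0 := by
  obtain ⟨U, hU, hμ⟩ := Circle.exists_ultrafilter_tendsto_pow
  have h1 : Tendsto (fun n => ‖z - (D.endo ^ n) z‖) U (𝓝 0) := by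
    have h := (tendsto_const_nhds (x := z)).sub (tendsto_pow_of_mem_peripheralSpace D.θ hμ hz)
    rw [sub_self] at h
    exact tendsto_zero_iff_norm_tendsto_zero.1 h
  have h2 : ∀ n, ‖D.proj n * z * D.proj n‖ ≤ ‖z - (D.endo ^ n) z‖ := by
    intro n
    have h3 : D.proj n * z * D.proj n = D.proj n * (z - (D.endo ^ n) z) * D.proj n := by
      rw [mul_sub, sub_mul, proj_mul_mul_proj, h0]
      have : D.incl 0 = 0 := by simpa using D.incl_smul 0 0
      rw [this, map_zero, sub_zero]
    rw [h3]
    calc _ ≤ ‖D.proj n‖ * ‖z - (D.endo ^ n) z‖ * ‖D.proj n‖ :=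
          (norm_mul_le _ _).trans (mul_le_mul_of_nonneg_right (norm_mul_le _ _) (norm_nonneg _))
      _ ≤ 1 * ‖z - (D.endo ^ n) z‖ * 1 := by
          gcongr <;> exact D.norm_proj_le n
      _ = _ := by ring
  have h4 : IsStrongLimit (fun n => D.proj n * z * D.proj n) (1 * z * 1) := by
    have hp := D.isStrongLimit_proj hone
    refine IsStrongLimit.mul (C := 1 * ‖z‖) (fun n => ?_) (IsStrongLimit.mul (t := fun _ => z)
      D.norm_proj_le hp fun _ => tendsto_const_nhds) hp
    exact (norm_mul_le _ _).trans
      (mul_le_mul_of_nonneg_right (D.norm_proj_le n) (norm_nonneg _))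
  rw [one_mul, mul_one] at h4
  refine elt_ext fun k => ?_
  have h5 : Tendsto (fun n => ((D.proj n * z * D.proj n : Elt D.B) : K →L[ℂ] K) k) U (𝓝 0) := by
    have h6 : Tendsto (fun n => ‖z - (D.endo ^ n) z‖ * ‖k‖) U (𝓝 0) := by
      simpa using h1.mul_const ‖k‖
    exact squeeze_zero_norm (fun n => ContinuousLinearMap.le_of_opNorm_le _ (h2 n) _) h6
  exact tendsto_nhds_unique ((h4 k).mono_left hU) h5

theorem lift_eq_of_isStrongLimit_orbit (hone : τ 1 = 1) {μ : Circle} {x : Elt A}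
    (hx : x ∈ eig τ μ) {z : Elt D.B} (hz : IsStrongLimit (D.orbit μ x) z) : D.lift x = z := by
  have hzm : z ∈ peripheralSpace D.endo := Submodule.le_topologicalClosure _
    (Submodule.mem_iSup_of_mem μ (D.mem_eig_of_isStrongLimit_orbit hz))
  have hT := D.T_eq_of_isStrongLimit_orbit hx hz
  have hex : ∃ w ∈ (peripheralSpace D.endo : Set (Elt D.B)), D.T w = x := ⟨z, hzm, hT⟩
  have h1 : D.lift x ∈ peripheralSpace D.endo := Function.invFunOn_mem hex
  have h2 : D.T (D.lift x) = x := Function.invFunOn_eq hex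
  refine sub_eq_zero.1 (D.eq_zero_of_T_eq_zero hone (sub_mem h1 hzm) ?_)
  rw [T_sub, h2, hT, sub_self]

theorem mul_eq_pmul (hτ : IsNormalUCP τ) {μ ν : Circle} {x y : Elt A} (hx : x ∈ eig τ μ)
    (hy : y ∈ eig τ ν) : D.mul x y = pmul τ x y := by
  obtain ⟨z, hz⟩ := D.exists_isStrongLimit_orbit hτ.one hx
  obtain ⟨w, hw⟩ := D.exists_isStrongLimit_orbit hτ.one hy
  rw [mul, D.lift_eq_of_isStrongLimit_orbit hτ.one hx hz,
    D.lift_eq_of_isStrongLimit_orbit hτ.one hy hw]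
  refine (hτ.pmul_eq_of_isWeakLimit hx hy (IsStrongLimit.isWeakLimit ?_)).symm
  convert D.isStrongLimit_T (IsStrongLimit.mul (D.norm_orbit_le μ x) hz hw) using 2 with n
  rw [orbit, orbit, smul_mul_smul_comm, ← pow_map_mul, ← incl_mul, T_smul, T_pow_incl, rotated,
    ← Circle.coe_mul, ← mul_pow, mul_inv]

end MinimalDilation

end PeripheralPoisson

namespace PeripheralPoisson

section Eigenspaces

variable {H : Type u} [NormedAddCommGroup H] [InnerProductSpace ℂ H] [CompleteSpace H]
variable {A : VonNeumannAlgebra H} {τ : Module.End ℂ (Elt A)} {lam : Circle} {v w : Elt A}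

theorem rank_le_of_leftInverse {M : Type*} [AddCommGroup M] [Module ℂ M] {E F : Submodule ℂ M}
    (f g : M → M) (hmem : ∀ x ∈ E, f x ∈ F) (hadd : ∀ x ∈ E, ∀ y ∈ E, f (x + y) = f x + f y)
    (hsmul : ∀ (c : ℂ), ∀ x ∈ E, f (c • x) = c • f x) (hg : ∀ x ∈ E, g (f x) = x) :
    Module.rank ℂ E ≤ Module.rank ℂ F := by
  let L : E →ₗ[ℂ] F :=
    { toFun := fun x => ⟨f x, hmem x x.2⟩
      map_add' := fun x y => Subtype.ext (hadd x x.2 y y.2)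
      map_smul' := fun c x => Subtype.ext (hsmul c x x.2) }
  refine L.rank_le_of_injective fun x y hxy => Subtype.ext ?_
  rw [← hg x x.2, ← hg y y.2]
  exact congrArg g (congrArg Subtype.val hxy)

namespace IsNormalUCP

variable (hτ : IsNormalUCP τ)
include hτ

theorem pmul_star_swap_eq_one {μ ν : Circle} (hv : v ∈ eig τ μ) (hw : w ∈ eig τ ν)
    (h : pmul τ v w = 1) : pmul τ (star w) (star v) = 1 := by
  rw [← hτ.star_pmul hv hw, h, star_one]

theorem eig_eq_pmul_right (hv : v ∈ eig τ lam) (hw : w ∈ eig τ lam)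
    (h : pmul τ (star v) w = 1) : (eig τ lam : Set (Elt A)) = {y | ∃ x ∈ fix τ, y = pmul τ x w} := by
  have hsv := hτ.star_mem hv
  ext y
  constructor
  · intro hy
    refine ⟨pmul τ y (star v), by simpa using hτ.pmul_mem hy hsv, ?_⟩
    rw [hτ.pmul_assoc hy hsv hw, h, hτ.pmul_one hy]
  · rintro ⟨x, hx, rfl⟩
    simpa using hτ.pmul_mem hx hw

theorem eig_eq_pmul_left (hv : v ∈ eig τ lam) (hw : w ∈ eig τ lam)
    (h : pmul τ v (star w) = 1) : (eig τ lam : Set (Elt A)) = {y | ∃ x ∈ fix τ, y = pmul τ v x} := by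
  have hsw := hτ.star_mem hw
  ext y
  constructor
  · intro hy
    refine ⟨pmul τ (star w) y, by simpa using hτ.pmul_mem hsw hy, ?_⟩
    rw [← hτ.pmul_assoc hv hsw hy, h, hτ.one_pmul hy]
  · rintro ⟨x, hx, rfl⟩
    simpa using hτ.pmul_mem hv hx

theorem rank_le_of_pmul_left {μ ν κ : Circle} (hv : v ∈ eig τ μ) (hw : w ∈ eig τ μ⁻¹)
    (h : pmul τ w v = 1) (hκ : μ * ν = κ) :
    Module.rank ℂ (eig τ ν) ≤ Module.rank ℂ (eig τ κ) :=
  rank_le_of_leftInverse (pmul τ v) (pmul τ w) (fun _ hx => hκ ▸ hτ.pmul_mem hv hx)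
    (fun _ hx _ hy => hτ.pmul_add hv hx hy) (fun c _ hx => hτ.pmul_smul c hv hx)
    fun _ hx => by rw [← hτ.pmul_assoc hw hv hx, h, hτ.one_pmul hx]

theorem rank_le_of_pmul_right {μ ν κ : Circle} (hv : v ∈ eig τ μ) (hw : w ∈ eig τ μ⁻¹)
    (h : pmul τ v w = 1) (hκ : ν * μ = κ) :
    Module.rank ℂ (eig τ ν) ≤ Module.rank ℂ (eig τ κ) :=
  rank_le_of_leftInverse (fun x => pmul τ x v) (fun x => pmul τ x w)
    (fun _ hx => hκ ▸ hτ.pmul_mem hx hv)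
    (fun _ hx _ hy => hτ.add_pmul hx hy hv) (fun c _ hx => hτ.smul_pmul c hx hv)
    fun _ hx => by rw [hτ.pmul_assoc hx hv hw, h, hτ.pmul_one hx]

theorem rank_eig_eq_of_pmul_eq_one {μ : Circle} (hv : v ∈ eig τ μ⁻¹) (hw : w ∈ eig τ μ)
    (h : pmul τ v w = 1) : Module.rank ℂ (eig τ μ) = Module.rank ℂ (fix τ) :=
  le_antisymm (hτ.rank_le_of_pmul_right hv (by rwa [inv_inv]) h (mul_inv_cancel μ))
    (hτ.rank_le_of_pmul_left hw hv h (mul_one μ))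

theorem rank_eig_eq_of_pmul_eq_one' {μ : Circle} (hv : v ∈ eig τ μ) (hw : w ∈ eig τ μ⁻¹)
    (h : pmul τ v w = 1) : Module.rank ℂ (eig τ μ) = Module.rank ℂ (fix τ) :=
  le_antisymm (hτ.rank_le_of_pmul_left hw (by rwa [inv_inv]) h (inv_mul_cancel μ))
    (hτ.rank_le_of_pmul_right hv hw h (one_mul μ))

end IsNormalUCP

end Eigenspaces

end PeripheralPoisson

theorem corollary2p9 {H : Type u} [NormedAddCommGroup H] [InnerProductSpace ℂ H] [CompleteSpace H]
    (A : VonNeumannAlgebra H) (φ : Elt A →CP Elt A)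
    (τ : Module.End ℂ (Elt A)) (hφ : τ = φ.toLinearMap) (hone : τ 1 = 1) (hnormal : IsNormal τ) :
    -- the product of two peripheral eigenvectors is the strong limit that it is defined to be
    (∀ (μ ν : Circle), ∀ x ∈ eig τ μ, ∀ y ∈ eig τ ν,
      IsStrongLimit (rotated τ μ ν x y) (pmul τ x y)) ∧
    -- it is the product obtained from any minimal dilation
    (∀ (K : Type v) [NormedAddCommGroup K] [InnerProductSpace ℂ K] [CompleteSpace K]
      (D : MinimalDilation τ K) (μ ν : Circle), ∀ x ∈ eig τ μ, ∀ y ∈ eig τ ν,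
      D.mul x y = pmul τ x y) ∧
    ∀ lam : Circle,
      (∀ v₁ ∈ eig τ lam, ∀ v₂ ∈ eig τ lam, pmul τ (star v₁) v₂ = 1 →
        (eig τ lam : Set (Elt A)) = {y | ∃ x ∈ fix τ, y = pmul τ x v₂} ∧
        (eig τ lam : Set (Elt A)) = {y | ∃ x ∈ fix τ, y = pmul τ x v₁} ∧
        Module.rank ℂ (eig τ lam) = Module.rank ℂ (fix τ)) ∧
      (∀ v₁ ∈ eig τ lam, ∀ v₂ ∈ eig τ lam, pmul τ v₁ (star v₂) = 1 →
        (eig τ lam : Set (Elt A)) = {y | ∃ x ∈ fix τ, y = pmul τ v₂ x} ∧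
        (eig τ lam : Set (Elt A)) = {y | ∃ x ∈ fix τ, y = pmul τ v₁ x} ∧
        Module.rank ℂ (eig τ lam) = Module.rank ℂ (fix τ)) := by
  have hτ : IsNormalUCP τ := by
    refine ⟨?_, hone, hnormal⟩
    subst hφ
    exact φ.map_cstarMatrix_nonneg'
  refine ⟨fun μ ν x hx y hy => hτ.isStrongLimit_pmul hx hy,
    fun K _ _ _ D μ ν x hx y hy => D.mul_eq_pmul hτ hx hy, fun lam => ⟨?_, ?_⟩⟩
  · intro v₁ h₁ v₂ h₂ h
    have h' : pmul τ (star v₂) v₁ = 1 := by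
      simpa using hτ.pmul_star_swap_eq_one (hτ.star_mem h₁) h₂ h
    exact ⟨hτ.eig_eq_pmul_right h₁ h₂ h, hτ.eig_eq_pmul_right h₂ h₁ h',
      hτ.rank_eig_eq_of_pmul_eq_one (hτ.star_mem h₁) h₂ h⟩
  · intro v₁ h₁ v₂ h₂ h
    have h' : pmul τ v₂ (star v₁) = 1 := by
      simpa using hτ.pmul_star_swap_eq_one h₁ (hτ.star_mem h₂) h
    exact ⟨hτ.eig_eq_pmul_left h₂ h₁ h', hτ.eig_eq_pmul_left h₁ h₂ h,
      hτ.rank_eig_eq_of_pmul_eq_one' h₁ (hτ.star_mem h₂) h⟩
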